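/- Setting. Fix $h\in[1,2)$ and let $\phi(t)=\max(0,t)^h$. Let $\mu_1,\mu_2\in\mathbb{R}^d$ be orthogonal unit vectors and $\sigma>0$. Let $\mathcal{D}=\mathcal{D}_{\mu_1,\mu_2,\sigma,d}$ be the law of $(x,y)$ where $x=z+\xi$, $z$ is uniform on $\{\mu_1,-\mu_1,\mu_2,-\mu_2\}$, $\xi$ is independent of $z$ and uniform on the sphere of radius $\sqrt{d-2}\,\sigma$ in the orthogonal complement of $\mathrm{span}(\mu_1,\mu_2)$, and $y=(\mu_1^Tx)^2-(\mu_2^Tx)^2\in\{-1,1\}$. Let $m\ge 1$ be divisible by $4$ and let $a\in\{-1,1\}^m$ satisfy $\sum_i a_i=0$. For $W=(w_1,\dots,w_m)\in(\mathbb{R}^d)^m$ put $f_W(x)=\sum_{i=1}^m a_i\phi(w_i^Tx)$ and $\|W\|=\big(\frac1m\sum_i\|w_i\|_2^2\big)^{1/2}$. For a sample $S=((x_j,y_j))_{j\le n}$ put $\gamma(f,S)=\min_j y_jf(x_j)$ and $\gamma^*(S)=\sup_{\|W\|\le1}\gamma(f_W,S)$. The test loss is $\mathcal{L}_{\mathcal{D}}(f)=\Pr_{(x,y)\sim\mathcal{D}}[\mathrm{sign}(f(x))\ne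 \mathrm{sign}(y)]$, where $\mathrm{sign}(t)=1$ for $t\ge0$ and $-1$ for $t<0$. Let $\kappa_{\mathrm{gen}}$ be the (unique) positive solution $\kappa$ of $$2^{1/h}\sqrt{\frac{2}{\kappa}}=\sqrt{\frac{\kappa}{4+\kappa}}+\sqrt{\frac{16}{\kappa(4+\kappa)}}.$$ Theorem. Let $h\in[1,2)$, $\kappa<\kappa_{\mathrm{gen}}$ and $\epsilon>0$. There is a constant $c>0$, depending only on $h$, $\kappa$ and $\epsilon$, such that for all $n\ge1$, $d$ and $\sigma>0$ with $\frac{n}{d\sigma^2}=\kappa$ and $\frac dn\ge c$, all $m$ and $a$ as above, and all orthogonal unit vectors $\mu_1,\mu_2\in\mathbb{R}^d$, the following holds with probability at least $1-3e^{-n/c}$ over $S\sim\mathcal{D}^n$: there is a $W$ with $\|W\|=1$, $\gamma(f_W,S)\ge(1-\epsilon)\gamma^*(S)$, zero signal component (each $w_i$ has orthogonal projection $0$ onto $\mathrm{span}(\mu_1,\mu_2)$), and $\mathcal{L}_{\mathcal{D}}(f_W)=\frac12$. -/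

import Mathlib

open MeasureTheory
open scoped RealInnerProductSpace

noncomputable section

/-- The uniform probability measure on the sphere of radius `r` centred at the origin of a
finite-dimensional real inner product space `F`: the surface measure of the unit sphere, normalised
to total mass one and scaled by `r`. If `F` is the zero space, it is the point mass at `0`. -/
def uniformSphere (F : Type*) [NormedAddCommGroup F] [InnerProductSpace ℝ F]
    [FiniteDimensional ℝ F] [MeasurableSpace F] [BorelSpace F] (r : ℝ) : Measure F :=
  open Classical in
  if Subsingleton F then Measure.dirac 0
  else (((volume : Measure F).toSphere Set.univ)⁻¹ • (volume : Measure F).toSphere).map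
    (fun u : Metric.sphere (0 : F) 1 => r • (u : F))

/-- The plane spanned by the two signal directions. -/
def signalSpace {d : ℕ} (μ₁ μ₂ : EuclideanSpace ℝ (Fin d)) :
    Submodule ℝ (EuclideanSpace ℝ (Fin d)) :=
  Submodule.span ℝ {μ₁, μ₂}

/-- The uniform distribution on the four points `μ₁, -μ₁, μ₂, -μ₂`. -/
def clusterLaw {d : ℕ} (μ₁ μ₂ : EuclideanSpace ℝ (Fin d)) :
    Measure (EuclideanSpace ℝ (Fin d)) :=
  (4 : ENNReal)⁻¹ •
    (Measure.dirac μ₁ + Measure.dirac (-μ₁) + Measure.dirac μ₂ + Measure.dirac (-μ₂))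

/-- The law of the junk vector: uniform on the sphere of radius `√(d - 2) σ` in the orthogonal
complement of the signal plane. -/
def junkLaw {d : ℕ} (μ₁ μ₂ : EuclideanSpace ℝ (Fin d)) (σ : ℝ) :
    Measure ↥(signalSpace μ₁ μ₂)ᗮ :=
  uniformSphere ↥(signalSpace μ₁ μ₂)ᗮ (Real.sqrt ((d : ℝ) - 2) * σ)

/-- The XOR data distribution `𝒟_{μ₁, μ₂, σ, d}`: the law of `(x, y)`, where `x = z + ξ` with `z`
and `ξ` independent, `z` uniform on `{μ₁, -μ₁, μ₂, -μ₂}`, `ξ` a junk vector, and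
`y = ⟪μ₁, x⟫² - ⟪μ₂, x⟫²`. -/
def xorDistribution {d : ℕ} (μ₁ μ₂ : EuclideanSpace ℝ (Fin d)) (σ : ℝ) :
    Measure (EuclideanSpace ℝ (Fin d) × ℝ) :=
  (((clusterLaw μ₁ μ₂).prod (junkLaw μ₁ μ₂ σ)).map
      (fun p => p.1 + (p.2 : EuclideanSpace ℝ (Fin d)))).map
    (fun x => (x, ⟪μ₁, x⟫ ^ 2 - ⟪μ₂, x⟫ ^ 2))

/-- The activation `φ(t) = max(0, t)^h`. -/
def reluPow (h t : ℝ) : ℝ := (max 0 t) ^ h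

/-- The two-layer network `f_W(x) = ∑ i, a i * φ(⟪w i, x⟫)` with activation `reluPow h`. -/
def network {m d : ℕ} (h : ℝ) (a : Fin m → ℝ) (W : Fin m → EuclideanSpace ℝ (Fin d))
    (x : EuclideanSpace ℝ (Fin d)) : ℝ :=
  ∑ i, a i * reluPow h ⟪W i, x⟫

/-- The norm `‖W‖ = √(𝔼_i ‖w_i‖²)`, with `i` uniform in `Fin m`. -/
def weightNorm {m d : ℕ} (W : Fin m → EuclideanSpace ℝ (Fin d)) : ℝ :=
  Real.sqrt ((∑ i, ‖W i‖ ^ 2) / m)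

/-- The signal component `U = W Π`, where `Π` is the orthogonal projector onto the signal plane. -/
def signalComponent {m d : ℕ} (μ₁ μ₂ : EuclideanSpace ℝ (Fin d))
    (W : Fin m → EuclideanSpace ℝ (Fin d)) : Fin m → EuclideanSpace ℝ (Fin d) :=
  fun i => (signalSpace μ₁ μ₂).starProjection (W i)

/-- The margin `min_j y_j f(x_j)` of `f` on the (non-empty) sample `S`. -/
def margin {n d : ℕ} (f : EuclideanSpace ℝ (Fin d) → ℝ)
    (S : Fin n → EuclideanSpace ℝ (Fin d) × ℝ) : ℝ :=
  ⨅ j, (S j).2 * f (S j).1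

/-- The maximum margin `γ*(S) = sup_{‖W‖ ≤ 1} γ(f_W, S)`. -/
def maxMargin {m n d : ℕ} (h : ℝ) (a : Fin m → ℝ)
    (S : Fin n → EuclideanSpace ℝ (Fin d) × ℝ) : ℝ :=
  sSup {g : ℝ | ∃ W : Fin m → EuclideanSpace ℝ (Fin d),
    weightNorm W ≤ 1 ∧ g = margin (network h a W) S}

/-- The predicted label: the two-valued sign, with `0` counted as positive. -/
def signLabel (t : ℝ) : ℝ := if 0 ≤ t then 1 else -1

/-- The 0/1 loss, equal to `1` exactly when the signs disagree. -/
def zeroOneLoss (y y' : ℝ) : ℝ := if signLabel y = signLabel y' then 0 else 1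

/-- The test loss `𝔼_{(x, y) ∼ D} ℒ(f(x), y)` for the 0/1 loss. -/
def testLoss {d : ℕ} (D : Measure (EuclideanSpace ℝ (Fin d) × ℝ))
    (f : EuclideanSpace ℝ (Fin d) → ℝ) : ℝ :=
  ∫ p, zeroOneLoss (f p.1) p.2 ∂D

/-- `k` is the threshold `κ_gen` for the activation `reluPow h`, that is, the positive solution of
`2^{1/h} √(2/κ) = √(κ/(4+κ)) + √(16/(κ(4+κ)))`. -/
def IsKappaGen (h k : ℝ) : Prop :=
  0 < k ∧
    (2 : ℝ) ^ (1 / h) * Real.sqrt (2 / k) =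
      Real.sqrt (k / (4 + k)) + Real.sqrt (16 / (k * (4 + k)))

/-- The equation that defines the threshold has exactly one positive solution. -/
theorem isKappaGen_iff {h k : ℝ} (h1 : 1 ≤ h) (h2 : h < 2) :
    IsKappaGen h k ↔ k = (2 : ℝ) ^ (1 + 2 / h) - 4 := by
  have hpos : 0 < (2 : ℝ) ^ (1 + 2 / h) - 4 := by
    have hlt : (2 : ℝ) < 1 + 2 / h := by
      have : 1 < 2 / h := by rw [lt_div_iff₀ (by linarith)]; linarith
      linarith
    have := Real.rpow_lt_rpow_of_exponent_lt (x := 2) (by norm_num) hlt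
    norm_num at this
    linarith
  have key : (2 : ℝ) ^ (1 + 2 / h) = 2 * ((2 : ℝ) ^ (1 / h)) ^ 2 := by
    rw [Real.rpow_add (by norm_num), Real.rpow_one, ← Real.rpow_natCast, ← Real.rpow_mul (by norm_num)]
    congr 2
    push_cast
    ring
  have hp : 0 < (2 : ℝ) ^ (1 / h) := Real.rpow_pos_of_pos (by norm_num) _
  have main : ∀ k : ℝ, 0 < k → ((2 : ℝ) ^ (1 / h) * Real.sqrt (2 / k) =
      Real.sqrt (k / (4 + k)) + Real.sqrt (16 / (k * (4 + k))) ↔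
      k = (2 : ℝ) ^ (1 + 2 / h) - 4) := by
    intro k hk
    have e1 : Real.sqrt (k / (4 + k)) + Real.sqrt (16 / (k * (4 + k))) =
        Real.sqrt ((4 + k) / k) := by
      have a1 : k / (4 + k) = (k / 4) ^ 2 * (16 / (k * (4 + k))) := by field_simp; norm_num
      have a2 : (4 + k) / k = ((k + 4) / 4) ^ 2 * (16 / (k * (4 + k))) := by field_simp; ring
      rw [a1, a2, Real.sqrt_mul (by positivity), Real.sqrt_mul (by positivity),
        Real.sqrt_sq (by positivity), Real.sqrt_sq (by positivity)]
      ring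
    rw [e1, ← Real.sqrt_sq hp.le, ← Real.sqrt_mul (by positivity),
      Real.sqrt_inj (by positivity) (by positivity), key]
    rw [← mul_div_assoc, div_left_inj' hk.ne']
    constructor <;> intro H <;> linarith
  constructor
  · rintro ⟨hk, e⟩
    exact (main k hk).1 e
  · rintro rfl
    exact ⟨hpos, (main _ hpos).2 rfl⟩

end

/-!
Write a sample as `x = z + ξ` with signal `z` and junk `ξ`, put `R = (d - 2) σ²`, so that
`‖ξ‖² = R`, and let `δ` be a small multiple of `ε`. When `d / n` is large, the junk vectors of the
sample are nearly orthogonal, `‖∑ a j • ξ j‖² = (1 ± δ) R ∑ (a j)²` for all `a`, and each of the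
four clusters holds at least `(1 - δ) n / 4` samples. This is `IsTypical`; on it the argument is
deterministic.

*A network that ignores the signal.* By near-orthogonality there are vectors `v₊`, `v₋` in the
span of the junk with `⟪v₊, ξ j⟫ = 1` on the positive samples and `0` on the negative ones, and
conversely for `v₋`. Giving `v₊` to the neurons with `a i = 1` and `v₋` to the others yields, after
normalisation, margin about `(m / 2) (2 / κ)^{h/2}` (`exists_junk_network`). As the weights are
orthogonal to the signal, the output on a fresh sample is independent of its label, so the test loss
is exactly `1 / 2` (`testLoss_eq_half`).

*No network does much better.* The margin is at most the average of the margins over the four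
clusters. A neuron of weight `w` with `s = ⟪w, μ₁⟫` and junk responses `g j` contributes at most the
average of `φ (s + g j) + φ (-s + g j')` over pairs `(j, j')` from the clusters `μ₁` and `-μ₁`,
while near-orthogonality bounds `s²` plus `κ / 4` times the mean squares of `g` on the two clusters
by `(1 + O(δ)) ‖w‖²`. The scalar inequality (`reluPow_add_reluPow_le`)
`φ (s + g) + φ (-s + g') ≤ 2 ((s² + k (g² + g'²)) / (2 k))^{h/2}`, `k = κ / 4`,
and Jensen's inequality for `t ↦ t^{h/2}` give the upper bound `(1 + O(δ)) (m / 2) (2 / κ)^{h/2}`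
(`margin_le_of_isTypical`). The scalar inequality holds because `2 (1 + k) ≤ 2^{2/h}`, which is
`κ ≤ κ_gen`: with a single active term this is exactly what is needed, and with two active terms it
reduces to `(p + q)^v ≤ p^v + q^v + (2^v - 2) (p q)^{v/2}` for `v = 2 / h ∈ [1, 2]`.

*Typicality.* The cluster sizes follow from Hoeffding's inequality. For the Gram matrix, the uniform
law on the sphere is invariant under isometries, so in `𝔼 exp ⟪z, ξ⟫` the vector `z` can be replaced
by any vector with coordinates `± ‖z‖ / √(d - 2)`; averaging over the signs gives
`𝔼 exp ⟪z, ξ⟫ ≤ exp (σ² ‖z‖² / 2)` (`lintegral_exp_inner_le`). Integrating out one junk vector at a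
time bounds the exponential moments of `‖∑ a j • ξ j‖²`, and Chernoff's bound together with a
`1/2`-net of at most `5 ^ n` points makes the estimate uniform in `a` (`measure_gram_deviation_le`).
-/

/-! ### The two-cluster inequality for a single neuron -/

/-- Bernoulli's inequality bounds the left side by `(1 + s x) (1 - x)`, and weighted AM-GM gives
`x ^ (1 + s) ≤ (1 - s) x + s x²`; the two bounds coincide. -/
theorem one_add_rpow_mul_one_sub_le {x s : ℝ} (hx0 : 0 ≤ x) (hx1 : x ≤ 1) (hs0 : 0 ≤ s)
    (hs1 : s ≤ 1) : (1 + x) ^ s * (1 - x) ≤ 1 - x ^ (1 + s) := by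
  have hB : (1 + x) ^ s ≤ 1 + s * x :=
    rpow_one_add_le_one_add_mul_self (by linarith) hs0 hs1
  have hA : x ^ (1 + s) ≤ (1 - s) * x + s * x ^ 2 := by
    have := Real.geom_mean_le_arith_mean2_weighted (sub_nonneg.2 hs1) hs0 hx0 (sq_nonneg x)
      (by ring)
    refine le_trans (le_of_eq ?_) this
    rw [← Real.rpow_natCast x 2, ← Real.rpow_mul hx0,
      ← Real.rpow_add_of_nonneg hx0 (by linarith) (by push_cast; linarith)]
    congr 1
    push_cast
    ring
  nlinarith [mul_le_mul_of_nonneg_right hB (sub_nonneg.2 hx1)]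

/-- Divided by `x ^ (v / 2)`, the inequality says that
`x ↦ (1 + x) ^ v x ^ (-v / 2) - x ^ (v / 2) - x ^ (-v / 2)` is at most its value at `1`; this
function is monotone by `one_add_rpow_mul_one_sub_le`. -/
theorem one_add_rpow_le {x v : ℝ} (hx0 : 0 < x) (hx1 : x ≤ 1) (hv1 : 1 ≤ v) (hv2 : v ≤ 2) :
    (1 + x) ^ v ≤ 1 + x ^ v + (2 ^ v - 2) * x ^ (v / 2) := by
  set g : ℝ → ℝ := fun x => (1 + x) ^ v * x ^ (-(v / 2)) - x ^ (v / 2) - x ^ (-(v / 2)) with hg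
  have hder : ∀ y : ℝ, 0 < y → HasDerivAt g
      (v / 2 * y ^ (-(v / 2) - 1) * (1 - y ^ v - (1 + y) ^ (v - 1) * (1 - y))) y := by
    intro y hy
    have h1 : HasDerivAt (fun x : ℝ => (1 + x) ^ v) (1 * v * (1 + y) ^ (v - 1)) y :=
      ((hasDerivAt_id y).const_add 1).rpow_const (Or.inl (by simp; linarith))
    have h2 : ∀ p : ℝ, HasDerivAt (fun x : ℝ => x ^ p) (p * y ^ (p - 1)) y := fun p =>
      Real.hasDerivAt_rpow_const (Or.inl hy.ne')
    refine (((h1.mul (h2 (-(v / 2)))).sub (h2 (v / 2))).sub (h2 (-(v / 2)))).congr_deriv ?_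
    have e1 : (1 + y) ^ v = (1 + y) ^ (v - 1) * (1 + y) := by
      rw [← Real.rpow_add_one (by linarith)]; congr 1; ring
    have e2 : y ^ (-(v / 2)) = y ^ (-(v / 2) - 1) * y := by
      rw [← Real.rpow_add_one hy.ne']; congr 1; ring
    have e3 : y ^ (v / 2 - 1) = y ^ (-(v / 2) - 1) * y ^ v := by
      rw [← Real.rpow_add hy]; congr 1; ring
    rw [e1, e2, e3]
    ring
  have hmono : MonotoneOn g (Set.Ioc 0 1) := by
    apply monotoneOn_of_deriv_nonneg (convex_Ioc 0 1)
    · exact fun y hy => (hder y hy.1).continuousAt.continuousWithinAt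
    · intro y hy
      rw [interior_Ioc] at hy
      exact (hder y hy.1).differentiableAt.differentiableWithinAt
    · intro y hy
      rw [interior_Ioc] at hy
      rw [(hder y hy.1).deriv]
      have := one_add_rpow_mul_one_sub_le hy.1.le hy.2.le (s := v - 1) (by linarith) (by linarith)
      rw [show 1 + (v - 1) = v by ring] at this
      have hp : 0 < y ^ (-(v / 2) - 1) := Real.rpow_pos_of_pos hy.1 _
      exact mul_nonneg (by positivity) (by linarith)
  have := hmono ⟨hx0, hx1⟩ ⟨one_pos, le_rfl⟩ hx1
  simp only [hg, Real.one_rpow] at this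
  have hp : 0 < x ^ (v / 2) := Real.rpow_pos_of_pos hx0 _
  have e1 : x ^ (-(v / 2)) * x ^ (v / 2) = 1 := by
    rw [← Real.rpow_add hx0]; simp
  have e2 : x ^ v = x ^ (v / 2) * x ^ (v / 2) := by
    rw [← Real.rpow_add hx0]; congr 1; ring
  have := mul_le_mul_of_nonneg_right this hp.le
  have h3 : ((1 + x) ^ v * x ^ (-(v / 2)) - x ^ (v / 2) - x ^ (-(v / 2))) * x ^ (v / 2)
      = (1 + x) ^ v - x ^ v - 1 := by
    rw [e2]; linear_combination ((1 + x) ^ v - 1) * e1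
  rw [h3] at this
  norm_num at this
  linarith

theorem add_rpow_le_of_pos {p q v : ℝ} (hp : 0 < p) (hq : 0 < q) (hv1 : 1 ≤ v) (hv2 : v ≤ 2) :
    (p + q) ^ v ≤ p ^ v + q ^ v + (2 ^ v - 2) * (p * q) ^ (v / 2) := by
  wlog hqp : q ≤ p generalizing p q
  · have := this hq hp (le_of_not_ge hqp)
    rw [add_comm p q, mul_comm p q]; linarith
  have h := one_add_rpow_le (div_pos hq hp) ((div_le_one hp).2 hqp) hv1 hv2
  have hpv : 0 < p ^ v := Real.rpow_pos_of_pos hp v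
  have h := mul_le_mul_of_nonneg_left h hpv.le
  have e1 : p ^ v * (1 + q / p) ^ v = (p + q) ^ v := by
    rw [← Real.mul_rpow hp.le (by positivity)]; congr 1; field_simp
  have e2 : p ^ v * (q / p) ^ v = q ^ v := by
    rw [← Real.mul_rpow hp.le (by positivity)]; congr 1; field_simp
  have e3 : p ^ v * (q / p) ^ (v / 2) = (p * q) ^ (v / 2) := by
    have : p ^ v = (p * p) ^ (v / 2) := by
      rw [Real.mul_rpow hp.le hp.le, ← Real.rpow_add hp]; congr 1; ring
    rw [this, ← Real.mul_rpow (by positivity) (by positivity)]; congr 1; field_simp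
  rw [e1] at h
  have : p ^ v * (1 + (q / p) ^ v + (2 ^ v - 2) * (q / p) ^ (v / 2))
    = p ^ v + q ^ v + (2 ^ v - 2) * (p * q) ^ (v / 2) := by
    linear_combination e2 + (2 ^ v - 2) * e3
  linarith

theorem reluPow_of_nonpos {h t : ℝ} (hh : h ≠ 0) (ht : t ≤ 0) : reluPow h t = 0 := by
  rw [reluPow, max_eq_left ht, Real.zero_rpow hh]

theorem reluPow_of_nonneg {h t : ℝ} (ht : 0 ≤ t) : reluPow h t = t ^ h := by
  rw [reluPow, max_eq_right ht]

theorem reluPow_nonneg (h t : ℝ) : 0 ≤ reluPow h t :=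
  Real.rpow_nonneg (le_max_left _ _) _

theorem rpow_eq_sq_rpow_half {t : ℝ} (h : ℝ) (ht : 0 ≤ t) : t ^ h = (t ^ 2) ^ (h / 2) := by
  rw [← Real.rpow_natCast, ← Real.rpow_mul ht]; congr 1; push_cast; ring

/-- The case of the two-cluster inequality in which only one of the two responses is positive. -/
theorem rpow_le_of_one_active {h k s g : ℝ} (hh1 : 1 ≤ h) (hk : 0 < k)
    (hkh : 2 * (1 + k) ≤ 2 ^ (2 / h)) (hp : 0 ≤ s + g) {N : ℝ} (hN : s ^ 2 + k * g ^ 2 ≤ N) :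
    (s + g) ^ h ≤ 2 * (N / (2 * k)) ^ (h / 2) := by
  have h1 : (s + g) ^ 2 ≤ (2 * (1 + k)) * (N / (2 * k)) := by
    have e : (2 * (1 + k)) * (N / (2 * k)) = (1 + k) * N / k := by field_simp
    rw [e, le_div_iff₀ hk]
    nlinarith [sq_nonneg (s - k * g), mul_le_mul_of_nonneg_left hN (by linarith : 0 ≤ 1 + k)]
  have hN0 : 0 ≤ N := le_trans (by positivity) hN
  rw [rpow_eq_sq_rpow_half h hp]
  calc ((s + g) ^ 2) ^ (h / 2) ≤ ((2 * (1 + k)) * (N / (2 * k))) ^ (h / 2) :=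
        Real.rpow_le_rpow (sq_nonneg _) h1 (by linarith)
    _ = (2 * (1 + k)) ^ (h / 2) * (N / (2 * k)) ^ (h / 2) :=
        Real.mul_rpow (by positivity) (by positivity)
    _ ≤ 2 * (N / (2 * k)) ^ (h / 2) := by
        gcongr
        calc (2 * (1 + k)) ^ (h / 2) ≤ ((2 : ℝ) ^ (2 / h)) ^ (h / 2) :=
              Real.rpow_le_rpow (by positivity) hkh (by linarith)
          _ = 2 := by
              rw [← Real.rpow_mul (by norm_num)]
              have : 2 / h * (h / 2) = 1 := by field_simp
              rw [this, Real.rpow_one]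

/-- The case of the two-cluster inequality in which both responses `p = s + g` and `q = -s + g'` are
positive. Minimising over `s` leaves `p q + (p - q)² / r ≤ N / (2 k)` with `r = 2 ^ (2 / h)`,
and the left side is at least `((p ^ h + q ^ h) / 2) ^ (2 / h)` by `add_rpow_le_of_pos`. -/
theorem rpow_add_rpow_le_of_active {h k s p q : ℝ} (hh1 : 1 ≤ h) (hh2 : h ≤ 2) (hk : 0 < k)
    (hkh : 2 * (1 + k) ≤ 2 ^ (2 / h)) (hp : 0 < p) (hq : 0 < q) :
    p ^ h + q ^ h ≤ 2 * ((s ^ 2 + k * ((p - s) ^ 2 + (q + s) ^ 2)) / (2 * k)) ^ (h / 2) := by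
  have hh0 : 0 < h := by linarith
  set r : ℝ := 2 ^ (2 / h) with hr
  have hr0 : 0 < r := by positivity
  set N := s ^ 2 + k * ((p - s) ^ 2 + (q + s) ^ 2) with hN
  have hM : p * q + (p - q) ^ 2 / r ≤ N / (2 * k) := by
    have h1 : (p - q) ^ 2 / r ≤ (p - q) ^ 2 * ((1 + k) / (2 * (1 + 2 * k))) := by
      rw [div_eq_mul_inv]
      gcongr
      rw [inv_le_comm₀ hr0 (by positivity), inv_div, div_le_iff₀ (by positivity)]
      nlinarith [sq_nonneg k, mul_le_mul_of_nonneg_right hkh (by linarith : 0 ≤ 1 + k)]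
    have h2 : p * q + (p - q) ^ 2 * ((1 + k) / (2 * (1 + 2 * k))) ≤ N / (2 * k) := by
      rw [le_div_iff₀ (by positivity)]
      have e : (p * q + (p - q) ^ 2 * ((1 + k) / (2 * (1 + 2 * k)))) * (2 * k)
          = (k * (1 + k) * (p ^ 2 + q ^ 2) + 2 * k ^ 2 * p * q) / (1 + 2 * k) := by
        field_simp; ring
      rw [e, div_le_iff₀ (by positivity), hN]
      nlinarith [sq_nonneg ((1 + 2 * k) * s - k * (p - q))]
    linarith
  have hv1 : 1 ≤ 2 / h := by rw [le_div_iff₀ hh0]; linarith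
  have hv2 : 2 / h ≤ 2 := by rw [div_le_iff₀ hh0]; linarith
  have key := add_rpow_le_of_pos (Real.rpow_pos_of_pos hp h) (Real.rpow_pos_of_pos hq h) hv1 hv2
  have e : ∀ t : ℝ, 0 < t → (t ^ h) ^ (2 / h) = t ^ 2 := by
    intro t ht
    rw [← Real.rpow_mul ht.le, mul_div_cancel₀ _ hh0.ne', Real.rpow_two]
  have e' : (p ^ h * q ^ h) ^ (2 / h / 2) = p * q := by
    rw [← Real.mul_rpow hp.le hq.le, ← Real.rpow_mul (by positivity),
      show h * (2 / h / 2) = 1 by field_simp, Real.rpow_one]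
  rw [e p hp, e q hq, e', ← hr] at key
  have h3 : ((p ^ h + q ^ h) / 2) ^ (2 / h) ≤ N / (2 * k) := by
    rw [Real.div_rpow (by positivity) (by norm_num), ← hr]
    refine le_trans ?_ hM
    rw [div_le_iff₀ hr0, add_mul, div_mul_cancel₀ _ hr0.ne']
    linarith
  have h4 := Real.rpow_le_rpow (by positivity) h3 (by linarith : 0 ≤ h / 2)
  rw [← Real.rpow_mul (by positivity), show 2 / h * (h / 2) = 1 by field_simp, Real.rpow_one] at h4
  linarith

/-- The two-cluster inequality. Among all neurons of squared norm `s² + k (g² + g'²)` the total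
response to a sample of the cluster `u` and one of the cluster `-u` is largest for a neuron with
`s = 0` and `g = g'`. The hypothesis on `k` is sharp: it excludes concentrating on one cluster. -/
theorem reluPow_add_reluPow_le {h k : ℝ} (hh1 : 1 ≤ h) (hh2 : h ≤ 2) (hk : 0 < k)
    (hkh : 2 * (1 + k) ≤ 2 ^ (2 / h)) (s g g' : ℝ) :
    reluPow h (s + g) + reluPow h (-s + g') ≤
      2 * ((s ^ 2 + k * (g ^ 2 + g' ^ 2)) / (2 * k)) ^ (h / 2) := by
  have hh0 : h ≠ 0 := by linarith
  rcases le_or_gt (s + g) 0 with hp | hp <;> rcases le_or_gt (-s + g') 0 with hq | hq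
  · rw [reluPow_of_nonpos hh0 hp, reluPow_of_nonpos hh0 hq, add_zero]
    positivity
  · rw [reluPow_of_nonpos hh0 hp, reluPow_of_nonneg hq.le, zero_add]
    exact rpow_le_of_one_active hh1 hk hkh hq.le (by nlinarith [mul_nonneg hk.le (sq_nonneg g)])
  · rw [reluPow_of_nonpos hh0 hq, reluPow_of_nonneg hp.le, add_zero]
    exact rpow_le_of_one_active hh1 hk hkh hp.le (by nlinarith [mul_nonneg hk.le (sq_nonneg g')])
  · rw [reluPow_of_nonneg hp.le, reluPow_of_nonneg hq.le]
    refine (rpow_add_rpow_le_of_active (s := s) hh1 hh2 hk hkh hp hq).trans (le_of_eq ?_)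
    congr 4
    ring

/-! ### Averages, near-orthogonal families and dual vectors -/

/-- Jensen's inequality for the concave function `t ↦ t ^ p` and a uniform average. -/
theorem expect_rpow_le {ι : Type*} {s : Finset ι} (hs : s.Nonempty) {f : ι → ℝ}
    (hf : ∀ i ∈ s, 0 ≤ f i) {p : ℝ} (hp0 : 0 ≤ p) (hp1 : p ≤ 1) :
    s.expect (fun i => f i ^ p) ≤ (s.expect f) ^ p := by
  have hc : (0 : ℝ) < s.card := by exact_mod_cast hs.card_pos
  have := (Real.concaveOn_rpow hp0 hp1).le_map_sum (t := s) (w := fun _ => (s.card : ℝ)⁻¹) (p := f)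
    (fun i _ => by positivity) (by simp [hc.ne']) (fun i hi => hf i hi)
  simpa only [smul_eq_mul, ← Finset.mul_sum, Finset.expect_eq_sum_div_card, div_eq_inv_mul]
    using this

/-- The two-cluster inequality averaged over the pairs in `P ×ˢ P'`. Averaging over pairs, rather
than over each cluster separately, keeps the bound valid when a neuron responds to few samples. -/
theorem expect_reluPow_add_expect_reluPow_le {ι : Type*} {P P' : Finset ι} (hP : P.Nonempty)
    (hP' : P'.Nonempty) {h k : ℝ} (hh1 : 1 ≤ h) (hh2 : h ≤ 2) (hk : 0 < k)
    (hkh : 2 * (1 + k) ≤ 2 ^ (2 / h)) (s : ℝ) (g : ι → ℝ) :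
    P.expect (fun j => reluPow h (s + g j)) + P'.expect (fun j => reluPow h (-s + g j)) ≤
      2 * ((s ^ 2 + k * (P.expect (fun j => g j ^ 2) + P'.expect (fun j => g j ^ 2))) /
        (2 * k)) ^ (h / 2) := by
  have hL : ∀ F G : ι → ℝ,
      (P ×ˢ P').expect (fun x => F x.1 + G x.2) = P.expect F + P'.expect G := by
    intro F G
    rw [Finset.expect_add_distrib, Finset.expect_product, Finset.expect_product]
    simp [Finset.expect_const hP, Finset.expect_const hP']
  rw [← hL]
  refine (Finset.expect_le_expect fun x _ =>
    reluPow_add_reluPow_le hh1 hh2 hk hkh s (g x.1) (g x.2)).trans ?_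
  rw [← Finset.mul_expect]
  refine mul_le_mul_of_nonneg_left ?_ (by norm_num)
  refine (expect_rpow_le (hP.product hP') (fun x _ => by positivity) (by linarith)
    (by linarith)).trans (le_of_eq ?_)
  congr 1
  rw [← Finset.expect_div, Finset.expect_add_distrib, Finset.expect_const (hP.product hP'),
    ← Finset.mul_expect, hL (fun j => g j ^ 2) (fun j => g j ^ 2)]

/-- An upper bound for the synthesis map `a ↦ ∑ j, a j • ξ j` is one for its adjoint
`v ↦ (⟪v, ξ j⟫)`. -/
theorem sum_inner_sq_le {ι F : Type*} [Fintype ι] [NormedAddCommGroup F] [InnerProductSpace ℝ F]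
    {ξ : ι → F} {q : ℝ} (hq : 0 ≤ q)
    (hξ : ∀ a : ι → ℝ, ‖∑ j, a j • ξ j‖ ^ 2 ≤ q * ∑ j, a j ^ 2) (v : F) :
    ∑ j, ⟪v, ξ j⟫ ^ 2 ≤ q * ‖v‖ ^ 2 := by
  set A := ∑ j, ⟪v, ξ j⟫ ^ 2 with hA
  have hA0 : 0 ≤ A := Finset.sum_nonneg fun j _ => sq_nonneg _
  have h1 : A = ⟪v, ∑ j, ⟪v, ξ j⟫ • ξ j⟫ := by
    rw [inner_sum, hA]
    exact Finset.sum_congr rfl fun j _ => by rw [real_inner_smul_right]; ring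
  have h2 : A ^ 2 ≤ ‖v‖ ^ 2 * (q * A) := by
    have := abs_real_inner_le_norm v (∑ j, ⟪v, ξ j⟫ • ξ j)
    rw [← h1] at this
    calc A ^ 2 = |A| ^ 2 := (sq_abs A).symm
      _ ≤ (‖v‖ * ‖∑ j, ⟪v, ξ j⟫ • ξ j‖) ^ 2 := by gcongr
      _ = ‖v‖ ^ 2 * ‖∑ j, ⟪v, ξ j⟫ • ξ j‖ ^ 2 := by ring
      _ ≤ _ := by gcongr; exact hξ _
  rcases hA0.eq_or_lt with h0 | h0
  · rw [← h0]; positivity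
  · nlinarith

/-- A family that is bounded below in the sense of Riesz has, in its span, a vector with prescribed
inner products `b`, of squared norm at most `‖b‖² / q`. -/
theorem exists_combination_inner_eq {ι F : Type*} [Fintype ι] [NormedAddCommGroup F]
    [InnerProductSpace ℝ F] {ξ : ι → F} {q : ℝ} (hq : 0 < q)
    (hξ : ∀ a : ι → ℝ, q * ∑ j, a j ^ 2 ≤ ‖∑ j, a j • ξ j‖ ^ 2) (b : ι → ℝ) :
    ∃ c : ι → ℝ, (∀ i, ⟪∑ j, c j • ξ j, ξ i⟫ = b i) ∧
      q * ‖∑ j, c j • ξ j‖ ^ 2 ≤ ∑ j, b j ^ 2 := by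
  let L : (ι → ℝ) →ₗ[ℝ] (ι → ℝ) :=
    { toFun := fun a i => ⟪∑ j, a j • ξ j, ξ i⟫
      map_add' := fun a a' => by
        ext i
        simp only [Pi.add_apply, add_smul, Finset.sum_add_distrib, inner_add_left]
      map_smul' := fun t a => by
        ext i
        simp only [Pi.smul_apply, smul_eq_mul, mul_smul, ← Finset.smul_sum,
          real_inner_smul_left, RingHom.id_apply] }
  have hL : ∀ a : ι → ℝ, ‖∑ j, a j • ξ j‖ ^ 2 = ∑ i, a i * L a i := by
    intro a
    rw [← real_inner_self_eq_norm_sq]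
    conv_lhs => rw [inner_sum]
    exact Finset.sum_congr rfl fun j _ => by rw [real_inner_smul_right]; rfl
  have hinj : Function.Injective L := by
    rw [injective_iff_map_eq_zero]
    intro a ha
    have h1 := hξ a
    rw [hL a, ha] at h1
    have h2 : ∑ j, a j ^ 2 = 0 := by
      have : 0 ≤ ∑ j, a j ^ 2 := Finset.sum_nonneg fun j _ => sq_nonneg _
      simp only [Pi.zero_apply, mul_zero, Finset.sum_const_zero] at h1
      nlinarith
    ext j
    have := (Finset.sum_eq_zero_iff_of_nonneg fun j _ => sq_nonneg (a j)).1 h2 j (Finset.mem_univ j)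
    simpa using this
  obtain ⟨c, hc⟩ := (LinearMap.injective_iff_surjective.1 hinj) b
  refine ⟨c, fun i => congrFun hc i, ?_⟩
  have h1 := hξ c
  have h2 := hL c
  rw [hc] at h2
  have h3 : (∑ i, c i * b i) ^ 2 ≤ (∑ i, c i ^ 2) * ∑ i, b i ^ 2 :=
    Finset.sum_mul_sq_le_sq_mul_sq _ _ _
  rw [← h2] at h3
  set V := ‖∑ j, c j • ξ j‖ ^ 2
  have hB : 0 ≤ ∑ i, b i ^ 2 := Finset.sum_nonneg fun j _ => sq_nonneg _
  have hV : 0 ≤ V := sq_nonneg _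
  rcases hV.eq_or_lt with h0 | h0
  · rw [← h0]; simpa using hB
  · have : q * V ^ 2 ≤ V * ∑ i, b i ^ 2 := by
      nlinarith [mul_le_mul_of_nonneg_right h1 hB]
    nlinarith

/-! ### Networks on typical samples -/

section

variable {m n d : ℕ}

theorem reluPow_smul (h : ℝ) {c : ℝ} (hc : 0 ≤ c) (t : ℝ) :
    reluPow h (c * t) = c ^ h * reluPow h t := by
  have : max 0 (c * t) = c * max 0 t := by
    rw [← mul_zero c, ← mul_max_of_nonneg _ _ hc, mul_zero]
  rw [reluPow, this, Real.mul_rpow hc (le_max_left _ _), reluPow]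

theorem network_smul (h : ℝ) (a : Fin m → ℝ) {c : ℝ} (hc : 0 ≤ c)
    (W : Fin m → EuclideanSpace ℝ (Fin d)) (x : EuclideanSpace ℝ (Fin d)) :
    network h a (fun i => c • W i) x = c ^ h * network h a W x := by
  simp only [network, real_inner_smul_left, reluPow_smul h hc, Finset.mul_sum]
  exact Finset.sum_congr rfl fun i _ => by ring

theorem weightNorm_smul {c : ℝ} (hc : 0 ≤ c) (W : Fin m → EuclideanSpace ℝ (Fin d)) :
    weightNorm (fun i => c • W i) = c * weightNorm W := by
  simp only [weightNorm, norm_smul, mul_pow, ← Finset.mul_sum, mul_div_assoc, Real.norm_eq_abs,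
    sq_abs]
  rw [Real.sqrt_mul (sq_nonneg c), Real.sqrt_sq hc]

theorem margin_le (f : EuclideanSpace ℝ (Fin d) → ℝ)
    (S : Fin n → EuclideanSpace ℝ (Fin d) × ℝ) (j : Fin n) :
    margin f S ≤ (S j).2 * f (S j).1 :=
  ciInf_le (Set.finite_range _).bddBelow j

/-- The indices of the samples whose signal component is `c`. -/
noncomputable def clusterIndices (μ₁ μ₂ : EuclideanSpace ℝ (Fin d))
    (S : Fin n → EuclideanSpace ℝ (Fin d) × ℝ) (c : EuclideanSpace ℝ (Fin d)) : Finset (Fin n) :=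
  open Classical in {j | (signalSpace μ₁ μ₂).starProjection (S j).1 = c}

/-- The junk component of a sample `x`, as a vector of the orthogonal complement of the signal
plane. -/
noncomputable def junk (μ₁ μ₂ : EuclideanSpace ℝ (Fin d)) (x : EuclideanSpace ℝ (Fin d)) :
    ↥(signalSpace μ₁ μ₂)ᗮ :=
  (signalSpace μ₁ μ₂)ᗮ.orthogonalProjectionOnto x

/-- The typical samples: they have the almost sure form of the data distribution, no cluster is much
smaller than `n / 4`, and the quadratic form of the Gram matrix of the junk components is within a
factor `1 ± δ` of `R` times the identity. -/
structure IsTypical (μ₁ μ₂ : EuclideanSpace ℝ (Fin d)) (δ R : ℝ)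
    (S : Fin n → EuclideanSpace ℝ (Fin d) × ℝ) : Prop where
  signal_mem : ∀ j, (signalSpace μ₁ μ₂).starProjection (S j).1 ∈
    ({μ₁, -μ₁, μ₂, -μ₂} : Set (EuclideanSpace ℝ (Fin d)))
  label : ∀ j, (S j).2 = ⟪μ₁, (S j).1⟫ ^ 2 - ⟪μ₂, (S j).1⟫ ^ 2
  card : ∀ c ∈ ({μ₁, -μ₁, μ₂, -μ₂} : Set (EuclideanSpace ℝ (Fin d))),
    (1 - δ) * n / 4 ≤ (clusterIndices μ₁ μ₂ S c).card
  gram : ∀ a : Fin n → ℝ,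
    |‖∑ j, a j • junk μ₁ μ₂ (S j).1‖ ^ 2 - R * ∑ j, a j ^ 2| ≤ δ * (R * ∑ j, a j ^ 2)

section

variable {μ₁ μ₂ : EuclideanSpace ℝ (Fin d)}

theorem left_mem_signalSpace : μ₁ ∈ signalSpace μ₁ μ₂ :=
  Submodule.subset_span (by simp)

theorem right_mem_signalSpace : μ₂ ∈ signalSpace μ₁ μ₂ :=
  Submodule.subset_span (by simp)

theorem signal_add_junk (x : EuclideanSpace ℝ (Fin d)) :
    (signalSpace μ₁ μ₂).starProjection x + (junk μ₁ μ₂ x : EuclideanSpace ℝ (Fin d)) = x :=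
  (signalSpace μ₁ μ₂).starProjection_add_starProjection_orthogonal x

theorem inner_starProjection_of_mem {K : Submodule ℝ (EuclideanSpace ℝ (Fin d))}
    {u : EuclideanSpace ℝ (Fin d)} (hu : u ∈ K) (x : EuclideanSpace ℝ (Fin d)) :
    ⟪u, K.starProjection x⟫ = ⟪u, x⟫ := by
  rw [← Submodule.inner_starProjection_left_eq_right, Submodule.starProjection_eq_self_iff.2 hu]

theorem inner_eq_of_signal (w x : EuclideanSpace ℝ (Fin d)) :
    ⟪w, x⟫ = ⟪w, (signalSpace μ₁ μ₂).starProjection x⟫ + ⟪junk μ₁ μ₂ w, junk μ₁ μ₂ x⟫ := by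
  conv_lhs => rw [← signal_add_junk (μ₁ := μ₁) (μ₂ := μ₂) x, inner_add_right]
  congr 1
  exact (Submodule.inner_orthogonalProjectionOnto_eq_of_mem_right (junk μ₁ μ₂ x) w).symm

theorem inner_sq_add_norm_junk_sq_le {u : EuclideanSpace ℝ (Fin d)} (hu : ‖u‖ = 1)
    (huK : u ∈ signalSpace μ₁ μ₂) (w : EuclideanSpace ℝ (Fin d)) :
    ⟪w, u⟫ ^ 2 + ‖junk μ₁ μ₂ w‖ ^ 2 ≤ ‖w‖ ^ 2 := by
  have h1 := Submodule.norm_sq_eq_add_norm_sq_projection w (signalSpace μ₁ μ₂)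
  have h2 : ⟪w, u⟫ ^ 2 ≤ ‖(signalSpace μ₁ μ₂).starProjection w‖ ^ 2 := by
    rw [real_inner_comm, ← inner_starProjection_of_mem huK, ← sq_abs]
    have := abs_real_inner_le_norm u ((signalSpace μ₁ μ₂).starProjection w)
    rw [hu, one_mul] at this
    gcongr
  have h3 : ‖(signalSpace μ₁ μ₂).starProjection w‖
    = ‖(signalSpace μ₁ μ₂).orthogonalProjectionOnto w‖ := rfl
  rw [h3] at h2
  rw [junk]
  linarith

variable {δ R : ℝ} {S : Fin n → EuclideanSpace ℝ (Fin d) × ℝ}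

theorem mem_clusterIndices {c : EuclideanSpace ℝ (Fin d)} {j : Fin n} :
    j ∈ clusterIndices μ₁ μ₂ S c ↔ (signalSpace μ₁ μ₂).starProjection (S j).1 = c := by
  simp [clusterIndices]

/-- The label is `1` on the clusters `± μ₁` and `-1` on the clusters `± μ₂`. -/
theorem inner_sq_sub_inner_sq (h1 : ‖μ₁‖ = 1) (h2 : ‖μ₂‖ = 1) (h12 : ⟪μ₁, μ₂⟫ = 0)
    {x : EuclideanSpace ℝ (Fin d)} :
    ((signalSpace μ₁ μ₂).starProjection x ∈ ({μ₁, -μ₁} : Set (EuclideanSpace ℝ (Fin d))) →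
      ⟪μ₁, x⟫ ^ 2 - ⟪μ₂, x⟫ ^ 2 = 1) ∧
    ((signalSpace μ₁ μ₂).starProjection x ∈ ({μ₂, -μ₂} : Set (EuclideanSpace ℝ (Fin d))) →
      ⟪μ₁, x⟫ ^ 2 - ⟪μ₂, x⟫ ^ 2 = -1) := by
  have h21 : ⟪μ₂, μ₁⟫ = 0 := by rw [real_inner_comm]; exact h12
  rw [← inner_starProjection_of_mem (left_mem_signalSpace (μ₁ := μ₁) (μ₂ := μ₂)) x,
    ← inner_starProjection_of_mem (right_mem_signalSpace (μ₁ := μ₁) (μ₂ := μ₂)) x]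
  constructor <;> rintro (h | h) <;> rw [h] <;>
    simp [h12, h21, h1, h2]

/-- Bound for the response of a single neuron to two opposite clusters `u`, `-u`. The factor
`(1 + δ) / (1 - δ)` comes from the Gram matrix and from the cluster sizes. -/
theorem neuron_response_le (hS : IsTypical μ₁ μ₂ δ R S) (hn : 0 < n) (hδ0 : 0 ≤ δ) (hδ1 : δ < 1)
    (hR : 0 ≤ R) {h k : ℝ} (hh1 : 1 ≤ h) (hh2 : h ≤ 2) (hk : 0 < k)
    (hkh : 2 * (1 + k) ≤ 2 ^ (2 / h)) (hkR : 4 * k * R ≤ n)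
    {u : EuclideanSpace ℝ (Fin d)} (hu : ‖u‖ = 1) (huK : u ∈ signalSpace μ₁ μ₂)
    (hu0 : u ∈ ({μ₁, -μ₁, μ₂, -μ₂} : Set (EuclideanSpace ℝ (Fin d))))
    (hu1 : -u ∈ ({μ₁, -μ₁, μ₂, -μ₂} : Set (EuclideanSpace ℝ (Fin d))))
    (w : EuclideanSpace ℝ (Fin d)) :
    (clusterIndices μ₁ μ₂ S u).expect (fun j => reluPow h ⟪w, (S j).1⟫) +
      (clusterIndices μ₁ μ₂ S (-u)).expect (fun j => reluPow h ⟪w, (S j).1⟫) ≤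
      2 * ((1 + δ) / (1 - δ) * ‖w‖ ^ 2 / (2 * k)) ^ (h / 2) := by
  have hn' : (0 : ℝ) < n := by exact_mod_cast hn
  have hδ' : 0 < 1 - δ := by linarith
  set P := clusterIndices μ₁ μ₂ S u with hP
  set P' := clusterIndices μ₁ μ₂ S (-u) with hP'
  have hb : 0 < (1 - δ) * n / 4 := by positivity
  have hc := hS.card u hu0
  have hc' := hS.card (-u) hu1
  rw [← hP] at hc
  rw [← hP'] at hc'
  have hPn : P.Nonempty := by
    rw [← Finset.card_pos]; exact_mod_cast hb.trans_le hc
  have hPn' : P'.Nonempty := by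
    rw [← Finset.card_pos]; exact_mod_cast hb.trans_le hc'
  set g : Fin n → ℝ := fun j => ⟪junk μ₁ μ₂ w, junk μ₁ μ₂ (S j).1⟫ with hg
  have e1 : P.expect (fun j => reluPow h ⟪w, (S j).1⟫) =
      P.expect (fun j => reluPow h (⟪w, u⟫ + g j)) := by
    refine Finset.expect_congr rfl fun j hj => ?_
    rw [inner_eq_of_signal (μ₁ := μ₁) (μ₂ := μ₂) w, mem_clusterIndices.1 hj]
  have e2 : P'.expect (fun j => reluPow h ⟪w, (S j).1⟫) =
      P'.expect (fun j => reluPow h (-⟪w, u⟫ + g j)) := by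
    refine Finset.expect_congr rfl fun j hj => ?_
    rw [inner_eq_of_signal (μ₁ := μ₁) (μ₂ := μ₂) w, mem_clusterIndices.1 hj, inner_neg_right]
  rw [e1, e2]
  refine (expect_reluPow_add_expect_reluPow_le hPn hPn' hh1 hh2 hk hkh _ g).trans ?_
  have hsum : ∑ j, g j ^ 2 ≤ (1 + δ) * R * ‖junk μ₁ μ₂ w‖ ^ 2 := by
    refine sum_inner_sq_le (by positivity) (fun a => ?_) _
    have := (abs_le.1 (hS.gram a)).2
    nlinarith
  have hdisj : Disjoint P P' := by
    rw [Finset.disjoint_left]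
    intro j hj hj'
    have h0 : u = -u := (mem_clusterIndices.1 hj).symm.trans (mem_clusterIndices.1 hj')
    have : u = 0 := by
      have h2 : (2 : ℝ) • u = 0 := by rw [two_smul]; nth_rewrite 2 [h0]; exact add_neg_cancel u
      simpa using h2
    simp [this] at hu
  have hexp : P.expect (fun j => g j ^ 2) + P'.expect (fun j => g j ^ 2) ≤
      (∑ j, g j ^ 2) / ((1 - δ) * n / 4) := by
    rw [Finset.expect_eq_sum_div_card, Finset.expect_eq_sum_div_card]
    have hnn : ∀ Q : Finset (Fin n), 0 ≤ ∑ j ∈ Q, g j ^ 2 :=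
      fun Q => Finset.sum_nonneg fun j _ => sq_nonneg _
    calc _ ≤ (∑ j ∈ P, g j ^ 2) / ((1 - δ) * n / 4) + (∑ j ∈ P', g j ^ 2) / ((1 - δ) * n / 4) :=
          add_le_add (div_le_div_of_nonneg_left (hnn _) hb hc)
            (div_le_div_of_nonneg_left (hnn _) hb hc')
      _ = (∑ j ∈ P ∪ P', g j ^ 2) / ((1 - δ) * n / 4) := by
          rw [Finset.sum_union hdisj, add_div]
      _ ≤ _ := by
          gcongr
          exact Finset.subset_univ _
  have hPy := inner_sq_add_norm_junk_sq_le (μ₁ := μ₁) (μ₂ := μ₂) hu huK w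
  have hexp' : k * (P.expect (fun j => g j ^ 2) + P'.expect (fun j => g j ^ 2)) ≤
      (1 + δ) / (1 - δ) * ‖junk μ₁ μ₂ w‖ ^ 2 := by
    calc _ ≤ k * (((1 + δ) * R * ‖junk μ₁ μ₂ w‖ ^ 2) / ((1 - δ) * n / 4)) := by
          refine mul_le_mul_of_nonneg_left (hexp.trans ?_) hk.le
          gcongr
      _ = (4 * k * R / n) * ((1 + δ) / (1 - δ) * ‖junk μ₁ μ₂ w‖ ^ 2) := by
          field_simp
      _ ≤ 1 * ((1 + δ) / (1 - δ) * ‖junk μ₁ μ₂ w‖ ^ 2) := by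
          gcongr
          rw [div_le_one hn']; exact hkR
      _ = _ := one_mul _
  have hρ : 1 ≤ (1 + δ) / (1 - δ) := by rw [le_div_iff₀ hδ']; linarith
  have hfin : ⟪w, u⟫ ^ 2 + k * (P.expect (fun j => g j ^ 2) + P'.expect (fun j => g j ^ 2)) ≤
      (1 + δ) / (1 - δ) * ‖w‖ ^ 2 := by
    calc _ ≤ (1 + δ) / (1 - δ) * ⟪w, u⟫ ^ 2 + (1 + δ) / (1 - δ) * ‖junk μ₁ μ₂ w‖ ^ 2 :=
          add_le_add (le_mul_of_one_le_left (sq_nonneg _) hρ) hexp'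
      _ = (1 + δ) / (1 - δ) * (⟪w, u⟫ ^ 2 + ‖junk μ₁ μ₂ w‖ ^ 2) := by ring
      _ ≤ _ := by gcongr
  gcongr

end

end

/-! ### Margins on typical samples -/

section

variable {m n d : ℕ} {μ₁ μ₂ : EuclideanSpace ℝ (Fin d)} {δ R : ℝ}
  {S : Fin n → EuclideanSpace ℝ (Fin d) × ℝ}

theorem weightNorm_sq (W : Fin m → EuclideanSpace ℝ (Fin d)) :
    weightNorm W ^ 2 = (∑ i, ‖W i‖ ^ 2) / m :=
  Real.sq_sqrt (div_nonneg (Finset.sum_nonneg fun _ _ => sq_nonneg _) m.cast_nonneg)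

theorem eq_zero_of_weightNorm_eq_zero (hm : 0 < m) {W : Fin m → EuclideanSpace ℝ (Fin d)}
    (hW : weightNorm W = 0) (i : Fin m) : W i = 0 := by
  have hm' : (m : ℝ) ≠ 0 := by exact_mod_cast hm.ne'
  have hnn : ∀ i ∈ Finset.univ, 0 ≤ ‖W i‖ ^ 2 := fun i _ => sq_nonneg _
  rw [weightNorm, Real.sqrt_eq_zero (div_nonneg (Finset.sum_nonneg hnn) m.cast_nonneg),
    div_eq_zero_iff, or_iff_left hm', Finset.sum_eq_zero_iff_of_nonneg hnn] at hW
  simpa using hW i (Finset.mem_univ i)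

theorem weightNorm_le_one_iff (W : Fin m → EuclideanSpace ℝ (Fin d)) :
    weightNorm W ≤ 1 ↔ Finset.univ.expect (fun i => ‖W i‖ ^ 2) ≤ 1 := by
  rw [weightNorm, Real.sqrt_le_one, Finset.expect_eq_sum_div_card, Finset.card_univ,
    Fintype.card_fin]

/-- The margin of every network of norm at most one is nearly at most that of the network which
ignores the signal. -/
theorem margin_le_of_isTypical (hS : IsTypical μ₁ μ₂ δ R S) (hn : 0 < n) (hδ0 : 0 ≤ δ)
    (hδ1 : δ < 1) (hR : 0 ≤ R) {h k : ℝ} (hh1 : 1 ≤ h) (hh2 : h ≤ 2) (hk : 0 < k)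
    (hkh : 2 * (1 + k) ≤ 2 ^ (2 / h)) (hkR : 4 * k * R ≤ n)
    (h1 : ‖μ₁‖ = 1) (h2 : ‖μ₂‖ = 1) (h12 : ⟪μ₁, μ₂⟫ = 0)
    (hm : 0 < m) {a : Fin m → ℝ} (ha : ∀ i, a i = 1 ∨ a i = -1)
    {W : Fin m → EuclideanSpace ℝ (Fin d)} (hW : weightNorm W ≤ 1) :
    margin (network h a W) S ≤ m / 2 * ((1 + δ) / (1 - δ) / (2 * k)) ^ (h / 2) := by
  have hn' : (0 : ℝ) < n := by exact_mod_cast hn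
  have hm' : (0 : ℝ) < m := by exact_mod_cast hm
  have hδ' : 0 < 1 - δ := by linarith
  set γ := margin (network h a W) S with hγ
  set ρ := (1 + δ) / (1 - δ) / (2 * k) with hρ
  have hρ0 : 0 ≤ ρ := by positivity
  let φ : EuclideanSpace ℝ (Fin d) → Fin m → ℝ := fun u i =>
    (clusterIndices μ₁ μ₂ S u).expect (fun j => reluPow h ⟪W i, (S j).1⟫)
  have hφ0 : ∀ u i, 0 ≤ φ u i := fun u i => Finset.expect_nonneg fun j _ => reluPow_nonneg _ _
  -- the margin is at most the average of `y f(x)` over any one cluster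
  have hclus : ∀ u ∈ ({μ₁, -μ₁, μ₂, -μ₂} : Set (EuclideanSpace ℝ (Fin d))), ∀ y : ℝ,
      (∀ j ∈ clusterIndices μ₁ μ₂ S u, (S j).2 = y) → γ ≤ ∑ i, y * a i * φ u i := by
    intro u hu y hy
    have hne : (clusterIndices μ₁ μ₂ S u).Nonempty := by
      rw [← Finset.card_pos]
      have : (0 : ℝ) < (1 - δ) * n / 4 := by positivity
      exact_mod_cast this.trans_le (hS.card u hu)
    calc γ = (clusterIndices μ₁ μ₂ S u).expect (fun _ => γ) := (Finset.expect_const hne _).symm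
      _ ≤ (clusterIndices μ₁ μ₂ S u).expect
            (fun j => ∑ i, y * a i * reluPow h ⟪W i, (S j).1⟫) := by
          refine Finset.expect_le_expect fun j hj => (margin_le _ S j).trans (le_of_eq ?_)
          rw [hy j hj, network, Finset.mul_sum]
          exact Finset.sum_congr rfl fun i _ => by ring
      _ = _ := by
          rw [Finset.expect_sum_comm]
          exact Finset.sum_congr rfl fun i _ => by rw [← Finset.mul_expect]
  have hyp : ∀ u ∈ ({μ₁, -μ₁} : Set (EuclideanSpace ℝ (Fin d))),
      ∀ j ∈ clusterIndices μ₁ μ₂ S u, (S j).2 = 1 := fun u hu j hj => by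
    rw [hS.label j]
    exact (inner_sq_sub_inner_sq h1 h2 h12).1 (by rw [mem_clusterIndices.1 hj]; exact hu)
  have hyn : ∀ u ∈ ({μ₂, -μ₂} : Set (EuclideanSpace ℝ (Fin d))),
      ∀ j ∈ clusterIndices μ₁ μ₂ S u, (S j).2 = -1 := fun u hu j hj => by
    rw [hS.label j]
    exact (inner_sq_sub_inner_sq h1 h2 h12).2 (by rw [mem_clusterIndices.1 hj]; exact hu)
  have i1 := hclus μ₁ (by simp) 1 (hyp _ (by simp))
  have i2 := hclus (-μ₁) (by simp) 1 (hyp _ (by simp))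
  have i3 := hclus μ₂ (by simp) (-1) (hyn _ (by simp))
  have i4 := hclus (-μ₂) (by simp) (-1) (hyn _ (by simp))
  have hneu : ∀ i, 1 * a i * φ μ₁ i + 1 * a i * φ (-μ₁) i + -1 * a i * φ μ₂ i +
      -1 * a i * φ (-μ₂) i ≤ 2 * (ρ * ‖W i‖ ^ 2) ^ (h / 2) := by
    intro i
    have e : ρ * ‖W i‖ ^ 2 = (1 + δ) / (1 - δ) * ‖W i‖ ^ 2 / (2 * k) := by rw [hρ]; ring
    have j1 := neuron_response_le hS hn hδ0 hδ1 hR hh1 hh2 hk hkh hkR h1 left_mem_signalSpace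
      (by simp) (by simp) (W i)
    have j2 := neuron_response_le hS hn hδ0 hδ1 hR hh1 hh2 hk hkh hkR h2 right_mem_signalSpace
      (by simp) (by simp) (W i)
    rw [← e] at j1 j2
    change φ μ₁ i + φ (-μ₁) i ≤ _ at j1
    change φ μ₂ i + φ (-μ₂) i ≤ _ at j2
    have := hφ0 μ₁ i
    have := hφ0 (-μ₁) i
    have := hφ0 μ₂ i
    have := hφ0 (-μ₂) i
    rcases ha i with h | h <;> rw [h] <;> linarith
  have hsum : 4 * γ ≤ ∑ i, 2 * (ρ * ‖W i‖ ^ 2) ^ (h / 2) := by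
    refine le_trans ?_ (Finset.sum_le_sum fun i _ => hneu i)
    simp only [Finset.sum_add_distrib]
    linarith
  have hjen : Finset.univ.expect (fun i => (ρ * ‖W i‖ ^ 2) ^ (h / 2)) ≤ ρ ^ (h / 2) := by
    have : Nonempty (Fin m) := ⟨⟨0, hm⟩⟩
    refine (expect_rpow_le Finset.univ_nonempty (fun i _ => by positivity) (by linarith)
      (by linarith)).trans ?_
    rw [← Finset.mul_expect]
    have := (weightNorm_le_one_iff W).1 hW
    refine Real.rpow_le_rpow
      (mul_nonneg hρ0 (Finset.expect_nonneg fun i _ => sq_nonneg _)) ?_ (by linarith)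
    nlinarith
  rw [Finset.expect_eq_sum_div_card, Finset.card_univ, Fintype.card_fin,
    div_le_iff₀ hm'] at hjen
  rw [← Finset.mul_sum] at hsum
  linarith

theorem sum_one_add_div_two {a : Fin m → ℝ} (ha0 : ∑ i, a i = 0) (c : ℝ) :
    ∑ i, (1 + c * a i) / 2 = m / 2 := by
  rw [← Finset.sum_div, Finset.sum_add_distrib, ← Finset.mul_sum, ha0]
  simp

/-- A network without signal component and with large margin. The neurons with `a i = 1` respond
with `1` to the positive samples and with `0` to the others, and those with `a i = -1`
conversely. -/
theorem exists_junk_network (hS : IsTypical μ₁ μ₂ δ R S) (hn : 0 < n) (hδ1 : δ < 1) (hR : 0 < R)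
    {h : ℝ} (hh1 : 1 ≤ h)
    (h1 : ‖μ₁‖ = 1) (h2 : ‖μ₂‖ = 1) (h12 : ⟪μ₁, μ₂⟫ = 0)
    (hm : 0 < m) {a : Fin m → ℝ} (ha : ∀ i, a i = 1 ∨ a i = -1) (ha0 : ∑ i, a i = 0) :
    ∃ W : Fin m → EuclideanSpace ℝ (Fin d), weightNorm W = 1 ∧
      (∀ i, W i ∈ (signalSpace μ₁ μ₂)ᗮ) ∧
      m / 2 * ((1 - δ) * R * 2 / n) ^ (h / 2) ≤ margin (network h a W) S := by
  have hn' : (0 : ℝ) < n := by exact_mod_cast hn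
  have hm' : (0 : ℝ) < m := by exact_mod_cast hm
  have hδ' : 0 < 1 - δ := by linarith
  set q := (1 - δ) * R with hq
  have hq0 : 0 < q := by positivity
  have hgram : ∀ c : Fin n → ℝ, q * ∑ j, c j ^ 2 ≤ ‖∑ j, c j • junk μ₁ μ₂ (S j).1‖ ^ 2 := by
    intro c
    have := (abs_le.1 (hS.gram c)).1
    rw [hq]; linarith
  have hy : ∀ j, (S j).2 = 1 ∨ (S j).2 = -1 := by
    intro j
    rw [hS.label j]
    have := hS.signal_mem j
    simp only [Set.mem_insert_iff, Set.mem_singleton_iff] at this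
    rcases this with H | H | H | H
    · exact Or.inl ((inner_sq_sub_inner_sq h1 h2 h12).1 (Or.inl H))
    · exact Or.inl ((inner_sq_sub_inner_sq h1 h2 h12).1 (Or.inr H))
    · exact Or.inr ((inner_sq_sub_inner_sq h1 h2 h12).2 (Or.inl H))
    · exact Or.inr ((inner_sq_sub_inner_sq h1 h2 h12).2 (Or.inr H))
  -- the target responses `1` on the label `t` and `0` on the other label
  have hv : ∀ t : ℝ, ∃ v : ↥(signalSpace μ₁ μ₂)ᗮ,
      (∀ j, ⟪v, junk μ₁ μ₂ (S j).1⟫ = (1 + t * (S j).2) / 2) ∧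
      q * ‖v‖ ^ 2 ≤ ∑ j, ((1 + t * (S j).2) / 2) ^ 2 := fun t => by
    obtain ⟨c, hc1, hc2⟩ := exists_combination_inner_eq hq0 hgram fun j => (1 + t * (S j).2) / 2
    exact ⟨_, hc1, hc2⟩
  choose v hv1 hv2 using hv
  set W₀ : Fin m → EuclideanSpace ℝ (Fin d) := fun i => (v (a i) : EuclideanSpace ℝ (Fin d))
    with hW₀
  have hresp : ∀ i j, ⟪W₀ i, (S j).1⟫ = (1 + a i * (S j).2) / 2 := by
    intro i j
    rw [← hv1, hW₀]
    exact (Submodule.inner_orthogonalProjectionOnto_eq_of_mem_left (v (a i)) (S j).1).symm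
  have hnet : ∀ j, (S j).2 * network h a W₀ (S j).1 = m / 2 := by
    intro j
    rw [network, Finset.mul_sum, ← sum_one_add_div_two ha0 (S j).2]
    refine Finset.sum_congr rfl fun i _ => ?_
    rw [hresp]
    have z : reluPow h 0 = 0 := reluPow_of_nonpos (by linarith) le_rfl
    have o : reluPow h 1 = 1 := by rw [reluPow_of_nonneg zero_le_one, Real.one_rpow]
    rcases ha i with H | H <;> rcases hy j with H' | H' <;> rw [H, H'] <;> norm_num [z, o]
  have hnorm : weightNorm W₀ ^ 2 ≤ n / (2 * q) := by
    have hb : ∀ i, q * ‖W₀ i‖ ^ 2 ≤ ∑ j, (1 + (S j).2 * a i) / 2 := by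
      intro i
      refine (hv2 (a i)).trans (le_of_eq (Finset.sum_congr rfl fun j _ => ?_))
      rcases ha i with H | H <;> rcases hy j with H' | H' <;> rw [H, H'] <;> norm_num
    have hb' := Finset.sum_le_sum fun i (_ : i ∈ Finset.univ) => hb i
    rw [Finset.sum_comm, ← Finset.mul_sum] at hb'
    simp only [sum_one_add_div_two ha0, Finset.sum_const, Finset.card_univ, Fintype.card_fin,
      nsmul_eq_mul] at hb'
    rw [weightNorm_sq, div_le_iff₀ hm', div_mul_eq_mul_div, le_div_iff₀ (by positivity)]
    linarith
  have hpos : 0 < weightNorm W₀ := by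
    refine (Real.sqrt_nonneg _).lt_of_ne fun hW0 => ?_
    have h0 : ∀ i, W₀ i = 0 := eq_zero_of_weightNorm_eq_zero hm hW0.symm
    have := hnet ⟨0, hn⟩
    have z : reluPow h 0 = 0 := reluPow_of_nonpos (by linarith) le_rfl
    simp only [network, h0, inner_zero_left, z, mul_zero, Finset.sum_const_zero] at this
    linarith
  set ω := weightNorm W₀ with hω
  refine ⟨fun i => ω⁻¹ • W₀ i, ?_, fun i => Submodule.smul_mem _ _ (v (a i)).2, ?_⟩
  · rw [weightNorm_smul (by positivity), ← hω, inv_mul_cancel₀ hpos.ne']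
  · have : Nonempty (Fin n) := ⟨⟨0, hn⟩⟩
    refine le_ciInf fun j => ?_
    rw [network_smul h a (by positivity), mul_left_comm, hnet, mul_comm (ω⁻¹ ^ h)]
    refine mul_le_mul_of_nonneg_left ?_ (by positivity)
    rw [rpow_eq_sq_rpow_half h (by positivity : 0 ≤ ω⁻¹)]
    refine Real.rpow_le_rpow (by positivity) ?_ (by linarith)
    rw [inv_pow, div_le_iff₀ hn', ← div_eq_inv_mul, le_div_iff₀ (by positivity)]
    rw [le_div_iff₀ (by positivity)] at hnorm
    linarith

/-- The lower and upper bounds for the margin differ by a factor of at least `1 - 4 δ`, as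
`(1 - δ) ^ 3 / (1 + δ) ≥ 1 - 4 δ` and `h / 2 ≤ 1`. -/
theorem ratio_bound {δ h : ℝ} (hδ0 : 0 ≤ δ) (hδ1 : δ < 1) (hh1 : 1 ≤ h) (hh2 : h ≤ 2) {A B : ℝ}
    (hA : 0 ≤ A) (hAB : (1 - δ) * A ≤ B) :
    (1 - 4 * δ) * ((1 + δ) / (1 - δ) * A) ^ (h / 2) ≤ ((1 - δ) * B) ^ (h / 2) := by
  have hδ' : 0 < 1 - δ := by linarith
  set θ := (1 - δ) ^ 3 / (1 + δ) with hθ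
  have hθ0 : 0 ≤ θ := by positivity
  have hθ1 : θ ≤ 1 := by
    rw [hθ, div_le_one (by linarith)]
    nlinarith [pow_le_one₀ hδ'.le (by linarith : 1 - δ ≤ 1) (n := 3)]
  have h1 : 1 - 4 * δ ≤ θ := by
    rw [hθ, le_div_iff₀ (by linarith)]
    nlinarith [mul_nonneg (sq_nonneg δ) (by linarith : 0 ≤ 7 - δ)]
  have h2 : θ ≤ θ ^ (h / 2) := Real.self_le_rpow_of_le_one hθ0 hθ1 (by linarith)
  calc _ ≤ θ ^ (h / 2) * ((1 + δ) / (1 - δ) * A) ^ (h / 2) := by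
        gcongr; linarith
    _ = ((1 - δ) * ((1 - δ) * A)) ^ (h / 2) := by
        rw [← Real.mul_rpow hθ0 (by positivity)]
        congr 1
        rw [hθ]
        field_simp
    _ ≤ _ := by gcongr

/-- On a typical sample some network without signal component has nearly maximal margin. -/
theorem exists_junk_network_near_optimal (hS : IsTypical μ₁ μ₂ δ R S) (hn : 0 < n) (hδ0 : 0 ≤ δ)
    (hδ1 : δ < 1) (hR : 0 < R) {h κ : ℝ} (hh1 : 1 ≤ h) (hh2 : h ≤ 2) (hκ : 0 < κ)
    (hκh : 4 + κ ≤ 2 ^ (1 + 2 / h)) (hκR : κ * R ≤ n) (hκR' : (1 - δ) * n ≤ κ * R)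
    (h1 : ‖μ₁‖ = 1) (h2 : ‖μ₂‖ = 1) (h12 : ⟪μ₁, μ₂⟫ = 0)
    (hm : 0 < m) {a : Fin m → ℝ} (ha : ∀ i, a i = 1 ∨ a i = -1) (ha0 : ∑ i, a i = 0) {ε : ℝ}
    (hε : 4 * δ ≤ ε) :
    ∃ W : Fin m → EuclideanSpace ℝ (Fin d), weightNorm W = 1 ∧
      (1 - ε) * maxMargin h a S ≤ margin (network h a W) S ∧
      ∀ i, W i ∈ (signalSpace μ₁ μ₂)ᗮ := by
  have hn' : (0 : ℝ) < n := by exact_mod_cast hn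
  have hm' : (0 : ℝ) < m := by exact_mod_cast hm
  have hδ' : 0 < 1 - δ := by linarith
  obtain ⟨W, hW1, hWK, hWm⟩ := exists_junk_network hS hn hδ1 hR hh1 h1 h2 h12 hm ha ha0
  refine ⟨W, hW1, ?_, hWK⟩
  have hkh : 2 * (1 + κ / 4) ≤ (2 : ℝ) ^ (2 / h) := by
    rw [Real.rpow_add (by norm_num), Real.rpow_one] at hκh
    linarith
  have hub : ∀ W : Fin m → EuclideanSpace ℝ (Fin d), weightNorm W ≤ 1 →
      margin (network h a W) S ≤ m / 2 * ((1 + δ) / (1 - δ) / (2 * (κ / 4))) ^ (h / 2) :=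
    fun W hW => margin_le_of_isTypical hS hn hδ0 hδ1 hR.le hh1 hh2 (by positivity) hkh
      (by linarith) h1 h2 h12 hm ha hW
  have hmax : maxMargin h a S ≤ m / 2 * ((1 + δ) / (1 - δ) / (2 * (κ / 4))) ^ (h / 2) := by
    refine csSup_le ⟨_, W, hW1.le, rfl⟩ ?_
    rintro g ⟨W', hW', rfl⟩
    exact hub W' hW'
  have hW_le : margin (network h a W) S ≤ maxMargin h a S := by
    refine le_csSup ⟨m / 2 * ((1 + δ) / (1 - δ) / (2 * (κ / 4))) ^ (h / 2), ?_⟩ ⟨W, hW1.le, rfl⟩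
    rintro g ⟨W', hW', rfl⟩
    exact hub W' hW'
  have hm0 : 0 ≤ margin (network h a W) S := by
    refine le_trans ?_ hWm
    positivity
  have hmax0 : 0 ≤ maxMargin h a S := hm0.trans hW_le
  have hr := ratio_bound hδ0 hδ1 hh1 hh2 (A := 2 / κ) (B := R * 2 / n) (by positivity) (by
    rw [mul_div_assoc', div_le_div_iff₀ hκ hn']; linarith)
  rw [show (1 + δ) / (1 - δ) * (2 / κ) = (1 + δ) / (1 - δ) / (2 * (κ / 4)) by field_simp; norm_num,
    show (1 - δ) * (R * 2 / n) = (1 - δ) * R * 2 / n by ring] at hr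
  have hr' := mul_le_mul_of_nonneg_left hr (by positivity : (0 : ℝ) ≤ m / 2)
  rcases le_or_gt (1 - 4 * δ) 0 with hneg | hpos
  · exact (mul_nonpos_of_nonpos_of_nonneg (by linarith) hmax0).trans hm0
  · calc (1 - ε) * maxMargin h a S ≤ (1 - 4 * δ) * maxMargin h a S := by gcongr
      _ ≤ (1 - 4 * δ) * (m / 2 * ((1 + δ) / (1 - δ) / (2 * (κ / 4))) ^ (h / 2)) := by gcongr
      _ ≤ _ := by linarith

end

/-! ### The uniform law on a sphere -/

section

open scoped Pointwise

variable {F : Type*} [NormedAddCommGroup F] [InnerProductSpace ℝ F]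
  [MeasurableSpace F] [BorelSpace F]

/-- A linear isometry, as a self-map of the unit sphere. -/
def sphereMap (e : F ≃ₗᵢ[ℝ] F) (u : Metric.sphere (0 : F) 1) : Metric.sphere (0 : F) 1 :=
  ⟨e u, by simp⟩

theorem measurable_sphereMap (e : F ≃ₗᵢ[ℝ] F) : Measurable (sphereMap e) :=
  (e.continuous.measurable.comp measurable_subtype_coe).subtype_mk

variable [FiniteDimensional ℝ F]

theorem map_sphereMap_toSphere (e : F ≃ₗᵢ[ℝ] F) :
    (volume : Measure F).toSphere.map (sphereMap e) = (volume : Measure F).toSphere := by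
  ext s hs
  rw [Measure.map_apply (measurable_sphereMap e) hs, Measure.toSphere_apply' _ hs,
    Measure.toSphere_apply' _ (measurable_sphereMap e hs)]
  congr 1
  have h : Set.Ioo (0 : ℝ) 1 • ((↑) '' (sphereMap e ⁻¹' s) : Set F) =
      e ⁻¹' (Set.Ioo (0 : ℝ) 1 • ((↑) '' s : Set F)) := by
    ext x
    simp only [Set.mem_smul, Set.mem_image, Set.mem_preimage]
    constructor
    · rintro ⟨t, ht, _, ⟨u, hu, rfl⟩, rfl⟩
      exact ⟨t, ht, _, ⟨_, hu, rfl⟩, by simp [sphereMap]⟩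
    · rintro ⟨t, ht, _, ⟨u, hu, rfl⟩, hx⟩
      refine ⟨t, ht, _, ⟨sphereMap e.symm u, ?_, rfl⟩, ?_⟩
      · have : sphereMap e (sphereMap e.symm u) = u := Subtype.ext (by simp [sphereMap])
        rwa [this]
      · apply e.injective
        rw [← hx]
        simp [sphereMap]
  rw [h]
  exact e.measurePreserving.measure_preimage_emb e.toHomeomorph.measurableEmbedding _

theorem map_uniformSphere (e : F ≃ₗᵢ[ℝ] F) (r : ℝ) :
    (uniformSphere F r).map e = uniformSphere F r := by
  have he : Measurable e := e.continuous.measurable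
  rw [uniformSphere]
  split_ifs with h
  · rw [Measure.map_dirac' he, map_zero]
  · have hm : Measurable fun u : Metric.sphere (0 : F) 1 => r • (u : F) := by fun_prop
    rw [Measure.map_map he hm]
    have : (e ∘ fun u : Metric.sphere (0 : F) 1 => r • (u : F)) =
        (fun u : Metric.sphere (0 : F) 1 => r • (u : F)) ∘ sphereMap e := by
      ext u; simp [sphereMap]
    rw [this, ← Measure.map_map hm (measurable_sphereMap e), Measure.map_smul,
      map_sphereMap_toSphere]

instance isProbabilityMeasure_uniformSphere (r : ℝ) :
    IsProbabilityMeasure (uniformSphere F r) := by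
  rw [uniformSphere]
  split_ifs with h
  · infer_instance
  · have hm : Measurable fun u : Metric.sphere (0 : F) 1 => r • (u : F) := by fun_prop
    have : Nontrivial F := not_subsingleton_iff_nontrivial.1 h
    constructor
    rw [Measure.map_apply hm .univ, Set.preimage_univ, Measure.smul_apply, smul_eq_mul]
    exact ENNReal.inv_mul_cancel
      (Measure.measure_univ_ne_zero.2 (volume : Measure F).toSphere_ne_zero) (measure_ne_top _ _)

theorem ae_norm_uniformSphere [Nontrivial F] {r : ℝ} (hr : 0 ≤ r) :
    ∀ᵐ x ∂uniformSphere F r, ‖x‖ = r := by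
  have hm : Measurable fun u : Metric.sphere (0 : F) 1 => r • (u : F) := by fun_prop
  rw [uniformSphere, if_neg (not_subsingleton F),
    ae_map_iff hm.aemeasurable (measurableSet_eq_fun (by fun_prop) (by fun_prop))]
  refine Filter.Eventually.of_forall fun u => ?_
  simp [norm_smul, abs_of_nonneg hr]

variable {ν : Measure F}

/-- Under a rotation invariant law the distribution of `⟪z, x⟫` depends on `‖z‖` only: the
reflection in the hyperplane orthogonal to `z - z'` exchanges `z` and `z'`. -/
theorem lintegral_inner_eq_of_norm_eq (hν : ∀ e : F ≃ₗᵢ[ℝ] F, ν.map e = ν) {z z' : F}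
    (h : ‖z‖ = ‖z'‖) {G : ℝ → ENNReal} (hG : Measurable G) :
    ∫⁻ x, G ⟪z, x⟫ ∂ν = ∫⁻ x, G ⟪z', x⟫ ∂ν := by
  set e := (ℝ ∙ (z - z'))ᗮ.reflection with he
  have hez : e z = z' := Submodule.reflection_sub h
  conv_rhs => rw [← hν e]
  rw [lintegral_map (by fun_prop) e.continuous.measurable, ← hez]
  simp only [LinearIsometryEquiv.inner_map_map]

/-- The sign `±1` encoded by a Boolean. -/
def boolSign (b : Bool) : ℝ := if b then 1 else -1

theorem sum_exp_boolSign {ι : Type*} [Fintype ι] [DecidableEq ι] (y : ι → ℝ) :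
    ∑ p : ι → Bool, Real.exp (∑ i, boolSign (p i) * y i) ≤
      2 ^ Fintype.card ι * Real.exp ((∑ i, y i ^ 2) / 2) := by
  have h1 : ∑ p : ι → Bool, Real.exp (∑ i, boolSign (p i) * y i) = ∏ i, (2 * Real.cosh (y i)) := by
    have := Finset.prod_univ_sum (fun _ : ι => (Finset.univ : Finset Bool))
      (fun i b => Real.exp (boolSign b * y i))
    rw [Fintype.piFinset_univ] at this
    simp only [Real.exp_sum]
    rw [← this]
    refine Finset.prod_congr rfl fun i _ => ?_
    rw [Real.cosh_eq]
    simp [boolSign]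
    ring
  rw [h1, Finset.prod_mul_distrib, Finset.prod_const, Finset.card_univ, Finset.sum_div,
    Real.exp_sum]
  gcongr with i
  exact Real.cosh_le_exp_half_sq _

/-- Under a rotation invariant law on a sphere of squared radius `D s`, linear functionals are
sub-Gaussian with variance proxy `s ‖z‖²`. All vectors with coordinates `± ‖z‖ / √D` in an
orthonormal basis give the same exponential moment as `z`; averaging over the signs turns it into
the mean of a product of hyperbolic cosines, bounded through `cosh t ≤ exp (t² / 2)` by a function
of `∑ x_i² = D s` alone. -/
theorem lintegral_exp_inner_le [IsProbabilityMeasure ν] (hν : ∀ e : F ≃ₗᵢ[ℝ] F, ν.map e = ν)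
    (hF : 0 < Module.finrank ℝ F) {s : ℝ}
    (hs : ∀ᵐ x ∂ν, ‖x‖ ^ 2 = Module.finrank ℝ F * s) (z : F) :
    ∫⁻ x, ENNReal.ofReal (Real.exp ⟪z, x⟫) ∂ν ≤ ENNReal.ofReal (Real.exp (s * ‖z‖ ^ 2 / 2)) := by
  set D := Module.finrank ℝ F with hD
  have hD' : (0 : ℝ) < D := by exact_mod_cast hF
  set b := stdOrthonormalBasis ℝ F with hb
  set c := ‖z‖ / Real.sqrt D with hc
  have hc2 : c ^ 2 = ‖z‖ ^ 2 / D := by rw [hc, div_pow, Real.sq_sqrt hD'.le]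
  let zs : (Fin D → Bool) → F := fun p => ∑ i, (boolSign (p i) * c) • b i
  have hz : ∀ p, ‖zs p‖ = ‖z‖ := by
    intro p
    have h1 : ‖zs p‖ ^ 2 = ‖z‖ ^ 2 := by
      rw [← real_inner_self_eq_norm_sq, b.orthonormal.inner_sum]
      have : ∀ i : Fin D, (starRingEnd ℝ) (boolSign (p i) * c) * (boolSign (p i) * c) = c ^ 2 := by
        intro i
        rcases p i <;> simp [boolSign] <;> ring
      simp only [this, Finset.sum_const, Finset.card_univ, Fintype.card_fin, nsmul_eq_mul, hc2]
      rw [← hD]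
      field_simp
    exact (sq_eq_sq₀ (norm_nonneg _) (norm_nonneg _)).1 h1
  have hinner : ∀ p x, ⟪zs p, x⟫ = ∑ i, boolSign (p i) * (c * ⟪b i, x⟫) := by
    intro p x
    simp only [zs, sum_inner, real_inner_smul_left, mul_assoc]
  have key : ∑ p : Fin D → Bool, ∫⁻ x, ENNReal.ofReal (Real.exp ⟪z, x⟫) ∂ν ≤
      2 ^ D * ENNReal.ofReal (Real.exp (s * ‖z‖ ^ 2 / 2)) := by
    calc _ = ∑ p : Fin D → Bool, ∫⁻ x, ENNReal.ofReal (Real.exp ⟪zs p, x⟫) ∂ν := by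
          refine Finset.sum_congr rfl fun p _ => ?_
          exact lintegral_inner_eq_of_norm_eq hν (hz p).symm
            (G := fun t => ENNReal.ofReal (Real.exp t)) (by fun_prop)
      _ = ∫⁻ x, ∑ p : Fin D → Bool, ENNReal.ofReal (Real.exp ⟪zs p, x⟫) ∂ν := by
          rw [lintegral_finsetSum]
          intro p _
          fun_prop
      _ ≤ ∫⁻ x, ENNReal.ofReal (2 ^ D * Real.exp (s * ‖z‖ ^ 2 / 2)) ∂ν := by
          refine lintegral_mono_ae ?_
          filter_upwards [hs] with x hx
          rw [← ENNReal.ofReal_sum_of_nonneg fun _ _ => (Real.exp_pos _).le]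
          apply ENNReal.ofReal_le_ofReal
          simp only [hinner]
          refine (sum_exp_boolSign _).trans (le_of_eq ?_)
          rw [Fintype.card_fin]
          congr 3
          simp only [mul_pow, ← Finset.mul_sum]
          have : ∑ i, ⟪b i, x⟫ ^ 2 = ‖x‖ ^ 2 := by
            rw [← b.sum_sq_norm_inner_right x]
            simp
          rw [this, hx, hc2]
          field_simp
      _ = _ := by
          rw [lintegral_const, measure_univ, mul_one, ENNReal.ofReal_mul (by positivity),
            ENNReal.ofReal_pow (by norm_num)]
          simp
  rw [Finset.sum_const, Finset.card_univ, Fintype.card_fun, Fintype.card_bool, Fintype.card_fin,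
    nsmul_eq_mul] at key
  push_cast at key
  exact (ENNReal.mul_le_mul_iff_right (by simp) (by simp)).1 key

end

/-! ### Sums of independent vectors of constant norm -/

/-- The induction step for the exponents in `lintegral_exp_norm_sum_sq_le`: integrating out one
vector with coefficient `√α` replaces the parameter `τ` by `τ + 2 τ² α`. -/
theorem exponent_step {τ α A : ℝ} (hα : 0 ≤ α) (hA : 0 ≤ A) (h : |τ| * (α + A) ≤ 1 / 8) :
    |(τ + 2 * τ ^ 2 * α) * A| ≤ 1 / 8 ∧
      τ * α + ((τ + 2 * τ ^ 2 * α) * A + 2 * ((τ + 2 * τ ^ 2 * α) * A) ^ 2) ≤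
        τ * (α + A) + 2 * (τ * (α + A)) ^ 2 := by
  have hτ := abs_nonneg τ
  have hTα : |τ| * α ≤ 1 / 8 := by nlinarith
  have hTA : |τ| * A ≤ 1 / 8 := by nlinarith
  have hu : |τ * A| ≤ 1 / 8 := by rwa [abs_mul, abs_of_nonneg hA]
  constructor
  · have h1 : |τ + 2 * τ ^ 2 * α| ≤ |τ| + 2 * |τ| ^ 2 * α := by
      refine (abs_add_le _ _).trans (le_of_eq ?_)
      rw [abs_of_nonneg (by positivity : 0 ≤ 2 * τ ^ 2 * α), sq_abs]
    rw [abs_mul, abs_of_nonneg hA]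
    nlinarith [mul_le_mul_of_nonneg_right h1 hA,
      mul_le_mul_of_nonneg_left hTA (by positivity : 0 ≤ 2 * |τ| * α)]
  · have h1 : α * A * (4 * (τ * A)) ≤ α * A * (1 / 2) := by
      have := (abs_le.1 hu).2
      gcongr; linarith
    have h2 : α ^ 2 * (4 * (τ * A) ^ 2) ≤ α ^ 2 * (1 / 16) := by
      have := sq_le_sq' (abs_le.1 hu).1 (abs_le.1 hu).2
      gcongr; linarith
    have h3 : 0 ≤ α * A := by positivity
    nlinarith [mul_le_mul_of_nonneg_left (add_le_add h1 h2) (sq_nonneg τ),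
      mul_nonneg (sq_nonneg τ) h3, mul_nonneg (sq_nonneg τ) (sq_nonneg α)]

section

variable {F : Type*} [NormedAddCommGroup F] [InnerProductSpace ℝ F] [FiniteDimensional ℝ F]
  [MeasurableSpace F] [BorelSpace F] {ν : Measure F}

/-- Integrating out one vector of a sum `α • x + Z`: the cross term is a linear functional
of `x`. -/
theorem lintegral_exp_norm_add_sq_le {D s : ℝ} (hs : ∀ᵐ x ∂ν, ‖x‖ ^ 2 = D * s)
    (hmgf : ∀ z : F, ∫⁻ x, ENNReal.ofReal (Real.exp ⟪z, x⟫) ∂ν ≤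
      ENNReal.ofReal (Real.exp (s * ‖z‖ ^ 2 / 2))) (α l : ℝ) (Z : F) :
    ∫⁻ x, ENNReal.ofReal (Real.exp (l * ‖α • x + Z‖ ^ 2)) ∂ν ≤
      ENNReal.ofReal (Real.exp (l * α ^ 2 * (D * s))) *
        ENNReal.ofReal (Real.exp ((l + 2 * l ^ 2 * α ^ 2 * s) * ‖Z‖ ^ 2)) := by
  have h1 : ∀ᵐ x ∂ν, ENNReal.ofReal (Real.exp (l * ‖α • x + Z‖ ^ 2)) =
      ENNReal.ofReal (Real.exp (l * α ^ 2 * (D * s) + l * ‖Z‖ ^ 2)) *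
        ENNReal.ofReal (Real.exp ⟪(2 * l * α) • Z, x⟫) := by
    filter_upwards [hs] with x hx
    rw [← ENNReal.ofReal_mul (Real.exp_pos _).le, ← Real.exp_add, norm_add_sq_real, norm_smul,
      mul_pow, hx, Real.norm_eq_abs, sq_abs, real_inner_smul_left, real_inner_smul_left,
      real_inner_comm]
    congr 2
    ring
  rw [lintegral_congr_ae h1, lintegral_const_mul _ (by fun_prop)]
  calc _ ≤ ENNReal.ofReal (Real.exp (l * α ^ 2 * (D * s) + l * ‖Z‖ ^ 2)) *
        ENNReal.ofReal (Real.exp (s * ‖(2 * l * α) • Z‖ ^ 2 / 2)) := by gcongr; exact hmgf _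
    _ = _ := by
        rw [← ENNReal.ofReal_mul (Real.exp_pos _).le, ← ENNReal.ofReal_mul (Real.exp_pos _).le,
          ← Real.exp_add, ← Real.exp_add, norm_smul, mul_pow, Real.norm_eq_abs, sq_abs]
        congr 2
        ring

/-- Exponential moments of the squared norm of a linear combination of independent vectors, for
parameters `l` of either sign. -/
theorem lintegral_exp_norm_sum_sq_le [IsProbabilityMeasure ν] {D s : ℝ} (hD : 0 ≤ D)
    (hs : ∀ᵐ x ∂ν, ‖x‖ ^ 2 = D * s)
    (hmgf : ∀ z : F, ∫⁻ x, ENNReal.ofReal (Real.exp ⟪z, x⟫) ∂ν ≤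
      ENNReal.ofReal (Real.exp (s * ‖z‖ ^ 2 / 2))) (n : ℕ) (a : Fin n → ℝ) (l : ℝ)
    (hl : |l * s| * ∑ j, a j ^ 2 ≤ 1 / 8) :
    ∫⁻ x, ENNReal.ofReal (Real.exp (l * ‖∑ j, a j • x j‖ ^ 2)) ∂(Measure.pi fun _ : Fin n => ν) ≤
      ENNReal.ofReal (Real.exp
        (D * (l * s * ∑ j, a j ^ 2 + 2 * (l * s * ∑ j, a j ^ 2) ^ 2))) := by
  induction n generalizing l with
  | zero => simp
  | succ n ih =>
    set A := ∑ j : Fin n, a j.succ ^ 2 with hA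
    have hA0 : 0 ≤ A := Finset.sum_nonneg fun j _ => sq_nonneg _
    set α := a 0 with hα
    rw [Fin.sum_univ_succ, ← hA, ← hα] at hl ⊢
    obtain ⟨st1, st2⟩ := exponent_step (sq_nonneg α) hA0 hl
    set l' := l + 2 * l ^ 2 * α ^ 2 * s with hl'
    have e' : l' * s = l * s + 2 * (l * s) ^ 2 * α ^ 2 := by rw [hl']; ring
    rw [← e'] at st1 st2
    have ih' := ih (fun j => a j.succ) l' (by
      rw [abs_mul, abs_of_nonneg hA0] at st1; exact st1)
    rw [← hA] at ih'
    have hmp := (measurePreserving_piFinSuccAbove (fun _ : Fin (n + 1) => ν) 0).symm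
    rw [← hmp.lintegral_comp_emb (MeasurableEquiv.measurableEmbedding _)]
    have e1 : ∀ p : F × (Fin n → F),
        ENNReal.ofReal (Real.exp (l * ‖∑ j, a j •
          (MeasurableEquiv.piFinSuccAbove (fun _ => F) 0).symm p j‖ ^ 2)) =
        ENNReal.ofReal (Real.exp (l * ‖α • p.1 + ∑ j, a j.succ • p.2 j‖ ^ 2)) := by
      intro p
      rw [Fin.sum_univ_succ]
      simp [MeasurableEquiv.piFinSuccAbove, hα]
    simp only [e1]
    rw [lintegral_prod_symm _ (by fun_prop)]
    calc _ ≤ ∫⁻ x : Fin n → F, ENNReal.ofReal (Real.exp (l * α ^ 2 * (D * s))) *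
          ENNReal.ofReal (Real.exp (l' * ‖∑ j, a j.succ • x j‖ ^ 2))
            ∂(Measure.pi fun _ : Fin n => ν) :=
          lintegral_mono fun x => lintegral_exp_norm_add_sq_le hs hmgf α l _
      _ ≤ ENNReal.ofReal (Real.exp (l * α ^ 2 * (D * s))) *
          ENNReal.ofReal (Real.exp (D * (l' * s * A + 2 * (l' * s * A) ^ 2))) := by
          rw [lintegral_const_mul _ (by fun_prop)]
          gcongr
      _ ≤ _ := by
          rw [← ENNReal.ofReal_mul (Real.exp_pos _).le, ← Real.exp_add]
          apply ENNReal.ofReal_le_ofReal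
          rw [Real.exp_le_exp]
          nlinarith [mul_le_mul_of_nonneg_left st2 hD]

/-- Chernoff's bound for the upper (`t = 1`) and the lower (`t = -1`) tail. -/
theorem measure_exp_tail_le [IsProbabilityMeasure ν] {D s δ : ℝ} (hD : 0 ≤ D) (hs0 : 0 < s)
    (hs : ∀ᵐ x ∂ν, ‖x‖ ^ 2 = D * s)
    (hmgf : ∀ z : F, ∫⁻ x, ENNReal.ofReal (Real.exp ⟪z, x⟫) ∂ν ≤
      ENNReal.ofReal (Real.exp (s * ‖z‖ ^ 2 / 2))) {n : ℕ} {a : Fin n → ℝ}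
    (ha : ∑ j, a j ^ 2 = 1) (hδ0 : 0 ≤ δ) (hδ : δ ≤ 1 / 2) {t : ℝ} (ht : t = 1 ∨ t = -1) :
    (Measure.pi fun _ : Fin n => ν)
      {x | δ * (D * s) ≤ t * (‖∑ j, a j • x j‖ ^ 2 - D * s)} ≤
      ENNReal.ofReal (Real.exp (-(D * δ ^ 2 / 8))) := by
  have ht2 : t ^ 2 = 1 := by rcases ht with h | h <;> rw [h] <;> norm_num
  -- this value of `l` minimises the exponent `D (2 (l s)² - |l s| δ)`
  set l := t * δ / (4 * s) with hl
  have hls : l * s = t * δ / 4 := by rw [hl]; field_simp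
  have hb := lintegral_exp_norm_sum_sq_le hD hs hmgf n a l (by
    rw [ha, hls, mul_one, abs_div, abs_mul]
    rcases ht with h | h <;> rw [h] <;> simp [abs_of_nonneg hδ0] <;> linarith)
  rw [ha, hls, mul_one] at hb
  set C := -(D * (t * δ / 4)) - D * δ ^ 2 / 4 with hC
  calc _ ≤ (Measure.pi fun _ : Fin n => ν) {x | 1 ≤ ENNReal.ofReal (Real.exp C) *
        ENNReal.ofReal (Real.exp (l * ‖∑ j, a j • x j‖ ^ 2))} := by
        refine measure_mono fun x hx => ?_
        simp only [Set.mem_ofPred_eq] at hx ⊢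
        rw [← ENNReal.ofReal_mul (Real.exp_pos _).le, ← Real.exp_add, ENNReal.one_le_ofReal,
          Real.one_le_exp_iff, hC, hl]
        have h1 : 0 ≤ (t * (‖∑ j, a j • x j‖ ^ 2 - D * s) - δ * (D * s)) * (δ / (4 * s)) :=
          mul_nonneg (by linarith) (by positivity)
        refine h1.trans (le_of_eq ?_)
        field_simp
        ring
    _ ≤ ENNReal.ofReal (Real.exp C) *
        ENNReal.ofReal (Real.exp (D * (t * δ / 4 + 2 * (t * δ / 4) ^ 2))) := by
        have hmeas : Measurable fun x : Fin n → F => ENNReal.ofReal (Real.exp C) *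
            ENNReal.ofReal (Real.exp (l * ‖∑ j, a j • x j‖ ^ 2)) := by fun_prop
        refine ((one_mul _).symm.le.trans (mul_meas_ge_le_lintegral hmeas 1)).trans ?_
        rw [lintegral_const_mul _ (by fun_prop)]
        gcongr
    _ = _ := by
        rw [← ENNReal.ofReal_mul (Real.exp_pos _).le, ← Real.exp_add]
        congr 2
        rw [hC]
        linear_combination D * δ ^ 2 / 8 * ht2

theorem measure_norm_sum_sq_deviation_le [IsProbabilityMeasure ν] {D s δ : ℝ} (hD : 0 ≤ D)
    (hs0 : 0 < s)
    (hs : ∀ᵐ x ∂ν, ‖x‖ ^ 2 = D * s)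
    (hmgf : ∀ z : F, ∫⁻ x, ENNReal.ofReal (Real.exp ⟪z, x⟫) ∂ν ≤
      ENNReal.ofReal (Real.exp (s * ‖z‖ ^ 2 / 2))) {n : ℕ} {a : Fin n → ℝ}
    (ha : ∑ j, a j ^ 2 = 1) (hδ0 : 0 ≤ δ) (hδ : δ ≤ 1 / 2) :
    (Measure.pi fun _ : Fin n => ν)
      {x | δ * (D * s) ≤ |‖∑ j, a j • x j‖ ^ 2 - D * s|} ≤
      2 * ENNReal.ofReal (Real.exp (-(D * δ ^ 2 / 8))) := by
  rw [two_mul]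
  refine le_trans ?_ (add_le_add
    (measure_exp_tail_le hD hs0 hs hmgf ha hδ0 hδ (Or.inl rfl))
    (measure_exp_tail_le hD hs0 hs hmgf ha hδ0 hδ (Or.inr rfl)))
  refine (measure_mono fun x hx => ?_).trans (measure_union_le _ _)
  rcases le_abs.1 (Set.mem_ofPred_eq ▸ hx) with h | h
  · exact Or.inl (by simpa using h)
  · exact Or.inr (by simpa using h)

end

/-! ### From a net to the whole sphere -/

/-- A `1/2`-net of the unit sphere with at most `5 ^ dim` points. -/
theorem exists_half_net (V : Type*) [NormedAddCommGroup V] [InnerProductSpace ℝ V]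
    [FiniteDimensional ℝ V] :
    ∃ N : Finset V, N.card ≤ 5 ^ Module.finrank ℝ V ∧ (∀ y ∈ N, ‖y‖ = 1) ∧
      ∀ x : V, ‖x‖ = 1 → ∃ y ∈ N, ‖x - y‖ ≤ 1 / 2 := by
  classical
  -- a `1/2`-separated subset of the sphere of maximal cardinality is a net
  let P : ℕ → Prop := fun c => ∃ N : Finset V, N.card = c ∧ (∀ y ∈ N, ‖y‖ = 1) ∧
    ∀ x ∈ N, ∀ y ∈ N, x ≠ y → 1 / 2 ≤ ‖x - y‖
  have hbound : ∀ c, P c → c ≤ 5 ^ Module.finrank ℝ V := by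
    rintro c ⟨N, rfl, h1, h2⟩
    have hinj : Function.Injective fun x : V => (2 : ℝ) • x :=
      smul_right_injective V (by norm_num)
    rw [← Finset.card_image_of_injective N hinj]
    refine Besicovitch.card_le_of_separated _ ?_ ?_
    · intro y hy
      obtain ⟨x, hx, rfl⟩ := Finset.mem_image.1 hy
      simp [norm_smul, h1 x hx]
    · intro y hy y' hy' hne
      obtain ⟨x, hx, rfl⟩ := Finset.mem_image.1 hy
      obtain ⟨x', hx', rfl⟩ := Finset.mem_image.1 hy'
      rw [← smul_sub, norm_smul]
      have := h2 x hx x' hx' fun h => hne (by rw [h])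
      norm_num
      linarith
  have h0 : P 0 := ⟨∅, by simp⟩
  obtain ⟨N, hN, h1, h2⟩ := Nat.findGreatest_spec (P := P) (Nat.zero_le (5 ^ Module.finrank ℝ V)) h0
  refine ⟨N, hN ▸ Nat.findGreatest_le _, h1, fun x hx => ?_⟩
  by_contra! hfar
  have hxN : x ∉ N := fun h => by have := hfar x h; norm_num at this
  have hP : P (N.card + 1) := by
    refine ⟨insert x N, Finset.card_insert_of_notMem hxN, ?_, ?_⟩
    · intro y hy
      rcases Finset.mem_insert.1 hy with rfl | hy
      · exact hx
      · exact h1 y hy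
    · intro y hy y' hy' hne
      rcases Finset.mem_insert.1 hy with rfl | h <;> rcases Finset.mem_insert.1 hy' with rfl | h'
      · exact absurd rfl hne
      · exact (hfar y' h').le
      · rw [norm_sub_rev]; exact (hfar y h).le
      · exact h2 y h y' h' hne
  have := Nat.le_findGreatest (hbound _ hP) hP
  omega

/-- A bound for the quadratic form `Q x = ‖T x‖² - R ‖x‖²` on a `1/2`-net of the sphere extends to
all vectors. If `|Q|` is maximal on the sphere at `x₀` and `y` is a nearby point of the net, then
`4 (Q x₀ - Q y) = Q p - Q q` with `p = 5/2 x₀ - 3/2 y`, `q = 3/2 x₀ - 5/2 y`, and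
`‖p‖² + ‖q‖² ≤ 31/8 < 4`, so the maximum is absorbed. -/
theorem abs_norm_map_sq_sub_le_of_net {V F : Type*} [NormedAddCommGroup V]
    [InnerProductSpace ℝ V] [FiniteDimensional ℝ V] [NormedAddCommGroup F] [InnerProductSpace ℝ F]
    (T : V →ₗ[ℝ] F) {N : Finset V} (hN1 : ∀ y ∈ N, ‖y‖ = 1)
    (hN : ∀ x : V, ‖x‖ = 1 → ∃ y ∈ N, ‖x - y‖ ≤ 1 / 2) {R η : ℝ}
    (h : ∀ y ∈ N, |‖T y‖ ^ 2 - R| ≤ η) (x : V) :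
    |‖T x‖ ^ 2 - R * ‖x‖ ^ 2| ≤ 32 * η * ‖x‖ ^ 2 := by
  set Q : V → ℝ := fun x => ‖T x‖ ^ 2 - R * ‖x‖ ^ 2 with hQ
  have hQs : ∀ (c : ℝ) (v : V), Q (c • v) = c ^ 2 * Q v := by
    intro c v
    simp only [hQ, map_smul, norm_smul, mul_pow, Real.norm_eq_abs, sq_abs]
    ring
  rcases eq_or_ne x 0 with rfl | hx
  · simp
  have hT : Continuous T := T.continuous_of_finiteDimensional
  have hQc : Continuous fun x => |Q x| := by fun_prop
  have hne : (Metric.sphere (0 : V) 1).Nonempty :=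
    ⟨‖x‖⁻¹ • x, by simp [norm_smul, hx]⟩
  obtain ⟨x₀, hx₀, hmax⟩ := (isCompact_sphere (0 : V) 1).exists_isMaxOn hne hQc.continuousOn
  have hx₀1 : ‖x₀‖ = 1 := by simpa using hx₀
  set B := |Q x₀| with hB
  have hle : ∀ v : V, |Q v| ≤ B * ‖v‖ ^ 2 := by
    intro v
    rcases eq_or_ne v 0 with rfl | hv
    · simp [hQ]
    · have hv' : ‖v‖ ≠ 0 := norm_ne_zero_iff.2 hv
      have h1 : |Q (‖v‖⁻¹ • v)| ≤ B := hmax (by simp [norm_smul, hv])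
      rw [hQs, abs_mul, abs_of_nonneg (sq_nonneg _), inv_pow, ← div_eq_inv_mul,
        div_le_iff₀ (by positivity)] at h1
      exact h1
  obtain ⟨y, hy, hxy⟩ := hN x₀ hx₀1
  have hy1 := hN1 y hy
  set p := (5 / 2 : ℝ) • x₀ - (3 / 2 : ℝ) • y with hp
  set q := (3 / 2 : ℝ) • x₀ - (5 / 2 : ℝ) • y with hq
  have hpol : 4 * (Q x₀ - Q y) = Q p - Q q := by
    simp only [hQ, hp, hq, map_sub, map_smul, norm_sub_sq_real, norm_smul, real_inner_smul_left,
      real_inner_smul_right, mul_pow, Real.norm_eq_abs, sq_abs]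
    ring
  have hin : 7 / 8 ≤ ⟪x₀, y⟫ := by
    have := norm_sub_sq_real x₀ y
    rw [hx₀1, hy1] at this
    nlinarith [norm_nonneg (x₀ - y)]
  have hpq : ‖p‖ ^ 2 + ‖q‖ ^ 2 ≤ 31 / 8 := by
    simp only [hp, hq, norm_sub_sq_real, norm_smul, real_inner_smul_left,
      real_inner_smul_right, mul_pow, Real.norm_eq_abs, sq_abs, hx₀1, hy1]
    linarith
  have hQy : |Q y| ≤ η := by
    have := h y hy
    simpa [hQ, hy1] using this
  have hBη : B ≤ 32 * η := by
    have h1 : Q x₀ = Q y + (Q p - Q q) / 4 := by linarith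
    have h2 : B ≤ |Q y| + (|Q p| + |Q q|) / 4 := by
      rw [hB, h1]
      refine (abs_add_le _ _).trans ?_
      rw [abs_div, abs_of_pos (by norm_num : (0 : ℝ) < 4)]
      gcongr
      exact abs_sub _ _
    have hB0 : 0 ≤ B := abs_nonneg _
    nlinarith [hle p, hle q, mul_le_mul_of_nonneg_left hpq hB0]
  exact (hle x).trans (by gcongr)

/-! ### Concentration of the Gram matrix and of the cluster sizes -/

section

variable {F : Type*} [NormedAddCommGroup F] [InnerProductSpace ℝ F] [FiniteDimensional ℝ F]
  [MeasurableSpace F] [BorelSpace F] {ν : Measure F}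

/-- With high probability the Gram matrix of `n` independent vectors is close to a multiple of the
identity, stated through its quadratic form. -/
theorem measure_gram_deviation_le [IsProbabilityMeasure ν] {D s δ : ℝ} (hD : 0 ≤ D) (hs0 : 0 < s)
    (hs : ∀ᵐ x ∂ν, ‖x‖ ^ 2 = D * s)
    (hmgf : ∀ z : F, ∫⁻ x, ENNReal.ofReal (Real.exp ⟪z, x⟫) ∂ν ≤
      ENNReal.ofReal (Real.exp (s * ‖z‖ ^ 2 / 2))) (n : ℕ) (hδ0 : 0 ≤ δ) (hδ : δ ≤ 1) :
    (Measure.pi fun _ : Fin n => ν)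
      {x | ¬ ∀ a : Fin n → ℝ, |‖∑ j, a j • x j‖ ^ 2 - D * s * ∑ j, a j ^ 2| ≤
        δ * (D * s * ∑ j, a j ^ 2)} ≤
      ENNReal.ofReal (2 * 5 ^ n * Real.exp (-(D * (δ / 32) ^ 2 / 8))) := by
  obtain ⟨N, hNc, hN1, hN⟩ := exists_half_net (EuclideanSpace ℝ (Fin n))
  rw [finrank_euclideanSpace_fin] at hNc
  let T : (Fin n → F) → EuclideanSpace ℝ (Fin n) →ₗ[ℝ] F := fun x =>
    { toFun := fun y => ∑ j, y j • x j
      map_add' := fun y y' => by simp [add_smul, Finset.sum_add_distrib]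
      map_smul' := fun c y => by simp [mul_smul, Finset.smul_sum] }
  calc _ ≤ (Measure.pi fun _ : Fin n => ν)
        (⋃ y ∈ N, {x | δ / 32 * (D * s) ≤ |‖∑ j, y j • x j‖ ^ 2 - D * s|}) := by
        refine measure_mono fun x hx => ?_
        by_contra hcon
        simp only [Set.mem_iUnion, Set.mem_ofPred_eq, not_exists, not_le] at hcon
        refine hx fun a => ?_
        have := abs_norm_map_sq_sub_le_of_net (T x) hN1 hN (fun y hy => (hcon y hy).le)
          (WithLp.toLp 2 a)
        rw [EuclideanSpace.real_norm_sq_eq] at this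
        refine this.trans (le_of_eq ?_)
        simp only
        ring
    _ ≤ ∑ y ∈ N, (Measure.pi fun _ : Fin n => ν)
          {x | δ / 32 * (D * s) ≤ |‖∑ j, y j • x j‖ ^ 2 - D * s|} :=
        measure_biUnion_finset_le _ _
    _ ≤ ∑ _y ∈ N, ENNReal.ofReal (2 * Real.exp (-(D * (δ / 32) ^ 2 / 8))) := by
        refine Finset.sum_le_sum fun y hy => ?_
        refine (measure_norm_sum_sq_deviation_le hD hs0 hs hmgf ?_ (by linarith)
          (by linarith)).trans (le_of_eq ?_)
        · rw [← EuclideanSpace.real_norm_sq_eq, hN1 y hy]; norm_num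
        · rw [ENNReal.ofReal_mul (by norm_num)]; simp
    _ ≤ _ := by
        rw [Finset.sum_const, nsmul_eq_mul, mul_comm (2 : ℝ) (5 ^ n), mul_assoc,
          ENNReal.ofReal_mul (p := 5 ^ n) (by positivity), ENNReal.ofReal_pow (by norm_num),
          ENNReal.ofReal_ofNat (n := 5)]
        have hc : (N.card : ENNReal) ≤ 5 ^ n := by exact_mod_cast hNc
        exact mul_le_mul_left hc _

end

theorem isClosed_gram {F : Type*} [NormedAddCommGroup F] [InnerProductSpace ℝ F] (n : ℕ)
    (R δ : ℝ) :
    IsClosed {x : Fin n → F | ∀ a : Fin n → ℝ, |‖∑ j, a j • x j‖ ^ 2 - R * ∑ j, a j ^ 2| ≤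
        δ * (R * ∑ j, a j ^ 2)} := by
  simp only [Set.ofPred_forall]
  exact isClosed_iInter fun a => isClosed_le (by fun_prop) (by fun_prop)

/-- Hoeffding's bound for the number of samples in an event of probability `1 / 4`, written as a sum
of indicators. -/
theorem measure_card_lt_le {Ω : Type*} [MeasurableSpace Ω] {ν : Measure Ω}
    [IsProbabilityMeasure ν] {A : Set Ω} (hA : MeasurableSet A) (hνA : ν.real A = 1 / 4)
    {n : ℕ} (hn : 0 < n) {δ : ℝ} (hδ : 0 ≤ δ) :
    (Measure.pi fun _ : Fin n => ν)
      {ω | ∑ j, A.indicator (fun _ => (1 : ℝ)) (ω j) < (1 - δ) * n / 4} ≤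
      ENNReal.ofReal (Real.exp (-(n * δ ^ 2 / 8))) := by
  have hn' : (0 : ℝ) < n := by exact_mod_cast hn
  set X : Ω → ℝ := fun ω => 1 / 4 - A.indicator (fun _ => 1) ω with hX
  have hXm : Measurable X := measurable_const.sub (measurable_const.indicator hA)
  have hXb : ∀ ω, X ω ∈ Set.Icc (-(3 / 4) : ℝ) (1 / 4) := by
    intro ω
    by_cases h : ω ∈ A <;> simp [hX, h] <;> norm_num
  have hmean : ∫ ω, X ω ∂ν = 0 := by
    rw [hX, integral_sub (integrable_const _) ((integrable_const _).indicator hA),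
      integral_indicator_const _ hA, hνA]
    simp
  have hind := ProbabilityTheory.iIndepFun_pi (μ := fun _ : Fin n => ν) (X := fun _ => X)
    (fun _ => hXm.aemeasurable)
  have hsub : ∀ j ∈ (Finset.univ : Finset (Fin n)),
      ProbabilityTheory.HasSubgaussianMGF (fun ω : Fin n → Ω => X (ω j))
        ((‖(1 / 4 : ℝ) - -(3 / 4)‖₊ / 2) ^ 2) (Measure.pi fun _ : Fin n => ν) := by
    intro j _
    refine ProbabilityTheory.hasSubgaussianMGF_of_mem_Icc_of_integral_eq_zero
      (hXm.comp (measurable_pi_apply j)).aemeasurable (Filter.Eventually.of_forall fun ω => hXb _)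
      ?_
    rw [integral_comp_eval (μ := fun _ : Fin n => ν) (f := X) hXm.aestronglyMeasurable, hmean]
  have := ProbabilityTheory.HasSubgaussianMGF.measure_sum_ge_le_of_iIndepFun hind hsub
    (ε := δ * n / 4) (by positivity)
  have e : -(δ * n / 4) ^ 2 / (2 * ↑(∑ _j : Fin n, (‖(1 / 4 : ℝ) - -(3 / 4)‖₊ / 2) ^ 2 : NNReal))
      = -(n * δ ^ 2 / 8) := by
    rw [show (1 / 4 : ℝ) - -(3 / 4) = 1 by norm_num]
    simp
    field_simp
    ring
  rw [e] at this
  refine (measure_mono (fun ω hω => ?_)).trans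
    ((ENNReal.le_ofReal_iff_toReal_le (measure_ne_top _ _) (Real.exp_pos _).le).2 this)
  simp only [Set.mem_ofPred_eq, hX, Finset.sum_sub_distrib] at hω ⊢
  simp
  linarith

/-! ### The data distribution -/

section

variable {d : ℕ} {μ₁ μ₂ : EuclideanSpace ℝ (Fin d)}

instance isProbabilityMeasure_clusterLaw (μ₁ μ₂ : EuclideanSpace ℝ (Fin d)) :
    IsProbabilityMeasure (clusterLaw μ₁ μ₂) := by
  constructor
  simp only [clusterLaw, Measure.smul_apply, Measure.add_apply, measure_univ, smul_eq_mul]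
  norm_num
  exact ENNReal.inv_mul_cancel (by norm_num) (by norm_num)

instance isProbabilityMeasure_junkLaw (μ₁ μ₂ : EuclideanSpace ℝ (Fin d)) (σ : ℝ) :
    IsProbabilityMeasure (junkLaw μ₁ μ₂ σ) :=
  isProbabilityMeasure_uniformSphere _

/-- The labelled sample with signal component `p.1` and junk component `p.2`. -/
noncomputable def assemble (μ₁ μ₂ : EuclideanSpace ℝ (Fin d))
    (p : EuclideanSpace ℝ (Fin d) × ↥(signalSpace μ₁ μ₂)ᗮ) : EuclideanSpace ℝ (Fin d) × ℝ :=
  (p.1 + (p.2 : EuclideanSpace ℝ (Fin d)),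
    ⟪μ₁, p.1 + (p.2 : EuclideanSpace ℝ (Fin d))⟫ ^ 2 -
      ⟪μ₂, p.1 + (p.2 : EuclideanSpace ℝ (Fin d))⟫ ^ 2)

theorem measurable_assemble : Measurable (assemble μ₁ μ₂) := by
  unfold assemble
  fun_prop

theorem xorDistribution_eq_map (σ : ℝ) :
    xorDistribution μ₁ μ₂ σ =
      ((clusterLaw μ₁ μ₂).prod (junkLaw μ₁ μ₂ σ)).map (assemble μ₁ μ₂) := by
  rw [xorDistribution, Measure.map_map (by fun_prop) (by fun_prop)]
  rfl

instance isProbabilityMeasure_xorDistribution (μ₁ μ₂ : EuclideanSpace ℝ (Fin d)) (σ : ℝ) :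
    IsProbabilityMeasure (xorDistribution μ₁ μ₂ σ) := by
  rw [xorDistribution_eq_map]
  exact Measure.isProbabilityMeasure_map measurable_assemble.aemeasurable

theorem ae_clusterLaw :
    ∀ᵐ z ∂clusterLaw μ₁ μ₂, z ∈ ({μ₁, -μ₁, μ₂, -μ₂} : Set (EuclideanSpace ℝ (Fin d))) := by
  rw [clusterLaw]
  refine Measure.ae_smul_measure ?_ _
  have hm : MeasurableSet ({μ₁, -μ₁, μ₂, -μ₂} : Set (EuclideanSpace ℝ (Fin d))) :=
    (Set.toFinite _).measurableSet
  have hd : ∀ u ∈ ({μ₁, -μ₁, μ₂, -μ₂} : Set (EuclideanSpace ℝ (Fin d))),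
      ∀ᵐ z ∂Measure.dirac u, z ∈ ({μ₁, -μ₁, μ₂, -μ₂} : Set (EuclideanSpace ℝ (Fin d))) :=
    fun u hu => (ae_dirac_iff
      (p := fun z => z ∈ ({μ₁, -μ₁, μ₂, -μ₂} : Set (EuclideanSpace ℝ (Fin d)))) hm).2 hu
  simp only [ae_add_measure_iff]
  exact ⟨⟨⟨hd _ (by simp), hd _ (by simp)⟩, hd _ (by simp)⟩, hd _ (by simp)⟩

theorem mem_signalSpace_of_mem {z : EuclideanSpace ℝ (Fin d)}
    (hz : z ∈ ({μ₁, -μ₁, μ₂, -μ₂} : Set (EuclideanSpace ℝ (Fin d)))) : z ∈ signalSpace μ₁ μ₂ := by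
  rcases hz with rfl | rfl | rfl | rfl
  · exact left_mem_signalSpace
  · exact neg_mem left_mem_signalSpace
  · exact right_mem_signalSpace
  · exact neg_mem right_mem_signalSpace

theorem starProjection_assemble {z : EuclideanSpace ℝ (Fin d)} (hz : z ∈ signalSpace μ₁ μ₂)
    (ξ : ↥(signalSpace μ₁ μ₂)ᗮ) :
    (signalSpace μ₁ μ₂).starProjection (z + (ξ : EuclideanSpace ℝ (Fin d))) = z := by
  rw [map_add, Submodule.starProjection_eq_self_iff.2 hz,
    (Submodule.starProjection_apply_eq_zero_iff _).2 ξ.2, add_zero]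

theorem junk_assemble {z : EuclideanSpace ℝ (Fin d)} (hz : z ∈ signalSpace μ₁ μ₂)
    (ξ : ↥(signalSpace μ₁ μ₂)ᗮ) :
    junk μ₁ μ₂ (z + (ξ : EuclideanSpace ℝ (Fin d))) = ξ := by
  rw [junk, map_add, Submodule.orthogonalProjectionOnto_mem_subspace_eq_self,
    Submodule.orthogonalProjectionOnto_eq_zero_iff.2 (Submodule.le_orthogonal_orthogonal _ hz),
    zero_add]

theorem ae_xorDistribution (σ : ℝ) :
    ∀ᵐ p ∂xorDistribution μ₁ μ₂ σ, (signalSpace μ₁ μ₂).starProjection p.1 ∈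
        ({μ₁, -μ₁, μ₂, -μ₂} : Set (EuclideanSpace ℝ (Fin d))) ∧
      p.2 = ⟪μ₁, p.1⟫ ^ 2 - ⟪μ₂, p.1⟫ ^ 2 := by
  have hm : MeasurableSet ({μ₁, -μ₁, μ₂, -μ₂} : Set (EuclideanSpace ℝ (Fin d))) :=
    (Set.toFinite _).measurableSet
  rw [xorDistribution_eq_map]
  refine (ae_map_iff measurable_assemble.aemeasurable
    (((signalSpace μ₁ μ₂).starProjection.measurable.comp measurable_fst hm).inter
      (measurableSet_eq_fun (by fun_prop) (by fun_prop)))).2 ?_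
  have h := Measure.quasiMeasurePreserving_fst (μ := clusterLaw μ₁ μ₂) (ν := junkLaw μ₁ μ₂ σ)
    |>.ae ae_clusterLaw
  filter_upwards [h] with p hp
  refine ⟨?_, rfl⟩
  change (signalSpace μ₁ μ₂).starProjection (p.1 + (p.2 : EuclideanSpace ℝ (Fin d))) ∈
    ({μ₁, -μ₁, μ₂, -μ₂} : Set (EuclideanSpace ℝ (Fin d)))
  rwa [starProjection_assemble (mem_signalSpace_of_mem hp)]

theorem measurable_junk : Measurable (junk μ₁ μ₂) :=
  (signalSpace μ₁ μ₂)ᗮ.orthogonalProjectionOnto.measurable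

theorem map_junk_xorDistribution (σ : ℝ) :
    (xorDistribution μ₁ μ₂ σ).map (fun p => junk μ₁ μ₂ p.1) = junkLaw μ₁ μ₂ σ := by
  have hm : Measurable fun p : EuclideanSpace ℝ (Fin d) × ℝ => junk μ₁ μ₂ p.1 :=
    measurable_junk.comp measurable_fst
  rw [xorDistribution_eq_map, Measure.map_map hm measurable_assemble]
  have h := Measure.quasiMeasurePreserving_fst (μ := clusterLaw μ₁ μ₂) (ν := junkLaw μ₁ μ₂ σ)
    |>.ae ae_clusterLaw
  have h' : ((fun p : EuclideanSpace ℝ (Fin d) × ℝ => junk μ₁ μ₂ p.1) ∘ assemble μ₁ μ₂) =ᵐ[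
      (clusterLaw μ₁ μ₂).prod (junkLaw μ₁ μ₂ σ)] Prod.snd := by
    filter_upwards [h] with p hp
    exact junk_assemble (mem_signalSpace_of_mem hp) p.2
  rw [Measure.map_congr h', Measure.map_snd_prod, measure_univ, one_smul]

theorem map_starProjection_xorDistribution (σ : ℝ) :
    (xorDistribution μ₁ μ₂ σ).map (fun p => (signalSpace μ₁ μ₂).starProjection p.1) =
      clusterLaw μ₁ μ₂ := by
  rw [xorDistribution_eq_map, Measure.map_map (by fun_prop) measurable_assemble]
  have h := Measure.quasiMeasurePreserving_fst (μ := clusterLaw μ₁ μ₂) (ν := junkLaw μ₁ μ₂ σ)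
    |>.ae ae_clusterLaw
  have h' : ((fun p : EuclideanSpace ℝ (Fin d) × ℝ => (signalSpace μ₁ μ₂).starProjection p.1) ∘
      assemble μ₁ μ₂) =ᵐ[(clusterLaw μ₁ μ₂).prod (junkLaw μ₁ μ₂ σ)] Prod.fst := by
    filter_upwards [h] with p hp
    exact starProjection_assemble (mem_signalSpace_of_mem hp) p.2
  rw [Measure.map_congr h', Measure.map_fst_prod, measure_univ, one_smul]

theorem clusterLaw_singleton (h1 : ‖μ₁‖ = 1) (h2 : ‖μ₂‖ = 1) (h12 : ⟪μ₁, μ₂⟫ = 0)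
    {c : EuclideanSpace ℝ (Fin d)}
    (hc : c ∈ ({μ₁, -μ₁, μ₂, -μ₂} : Set (EuclideanSpace ℝ (Fin d)))) :
    (clusterLaw μ₁ μ₂).real {c} = 1 / 4 := by
  have h21 : ⟪μ₂, μ₁⟫ = 0 := by rw [real_inner_comm]; exact h12
  have key : ∀ u v : EuclideanSpace ℝ (Fin d), ⟪μ₁, u⟫ ≠ ⟪μ₁, v⟫ ∨ ⟪μ₂, u⟫ ≠ ⟪μ₂, v⟫ → u ≠ v := by
    rintro u v h rfl
    simp at h
  have d1 : μ₁ ≠ -μ₁ := key _ _ (by norm_num [h1, h2, h12, h21])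
  have d2 : μ₁ ≠ μ₂ := key _ _ (by simp only [real_inner_self_eq_norm_sq]; norm_num [h1, h2, h12])
  have d3 : μ₁ ≠ -μ₂ := key _ _ (by
    simp only [inner_neg_right, real_inner_self_eq_norm_sq]; norm_num [h1, h2, h12])
  have d4 : -μ₁ ≠ μ₂ := key _ _ (by
    simp only [inner_neg_right, real_inner_self_eq_norm_sq]; norm_num [h1, h2, h12])
  have d5 : μ₂ ≠ -μ₂ := key _ _ (by norm_num [h1, h2, h12, h21])
  have e : clusterLaw μ₁ μ₂ {c} = 4⁻¹ := by
    simp only [clusterLaw, Measure.smul_apply, Measure.add_apply, smul_eq_mul,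
      Measure.dirac_apply' _ (measurableSet_singleton c)]
    rcases hc with rfl | rfl | rfl | rfl <;>
      simp [d1, d2, d3, d4, d5, d1.symm, d2.symm, d3.symm, d4.symm, d5.symm]
  rw [Measure.real, e]
  norm_num

/-- A network without signal component ignores the label: for each junk vector, two of the four
equally likely signals carry each label, so the loss is `1 / 2` whatever the output. -/
theorem testLoss_eq_half {m : ℕ} {h : ℝ} (h1 : ‖μ₁‖ = 1) (h2 : ‖μ₂‖ = 1)
    (h12 : ⟪μ₁, μ₂⟫ = 0)
    (σ : ℝ) (a : Fin m → ℝ) {W : Fin m → EuclideanSpace ℝ (Fin d)}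
    (hW : ∀ i, W i ∈ (signalSpace μ₁ μ₂)ᗮ) :
    testLoss (xorDistribution μ₁ μ₂ σ) (network h a W) = 1 / 2 := by
  have hnet : ∀ z ∈ signalSpace μ₁ μ₂, ∀ ξ : EuclideanSpace ℝ (Fin d),
      network h a W (z + ξ) = network h a W ξ := by
    intro z hz ξ
    simp only [network, inner_add_right]
    refine Finset.sum_congr rfl fun i _ => ?_
    rw [Submodule.inner_left_of_mem_orthogonal hz (hW i), zero_add]
  have hnm : Measurable (network h a W) := by
    unfold network reluPow
    fun_prop
  have hsm : Measurable signLabel :=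
    Measurable.ite measurableSet_Ici measurable_const measurable_const
  have hLm : Measurable fun p : EuclideanSpace ℝ (Fin d) × ℝ =>
      zeroOneLoss (network h a W p.1) p.2 :=
    Measurable.ite (measurableSet_eq_fun (hsm.comp (hnm.comp measurable_fst))
      (hsm.comp measurable_snd)) measurable_const measurable_const
  have hb : ∀ s t, ‖zeroOneLoss s t‖ ≤ 1 := by
    intro s t
    unfold zeroOneLoss
    split_ifs <;> simp
  have hLi : Integrable (fun p => zeroOneLoss (network h a W (assemble μ₁ μ₂ p).1)
      (assemble μ₁ μ₂ p).2) ((clusterLaw μ₁ μ₂).prod (junkLaw μ₁ μ₂ σ)) :=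
    Integrable.of_bound (hLm.comp measurable_assemble).aestronglyMeasurable 1
      (Filter.Eventually.of_forall fun p => hb _ _)
  rw [testLoss, xorDistribution_eq_map, integral_map measurable_assemble.aemeasurable
    hLm.aestronglyMeasurable, integral_prod_symm _ hLi]
  have hint : ∀ (g : EuclideanSpace ℝ (Fin d) → ℝ) (x : EuclideanSpace ℝ (Fin d)),
      Integrable g (Measure.dirac x) := fun g x => integrable_dirac (by simp)
  have hval : ∀ (ξ : ↥(signalSpace μ₁ μ₂)ᗮ),
      ∫ z, zeroOneLoss (network h a W (assemble μ₁ μ₂ (z, ξ)).1) (assemble μ₁ μ₂ (z, ξ)).2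
        ∂clusterLaw μ₁ μ₂ = 1 / 2 := by
    intro ξ
    have hlab : ∀ z ∈ signalSpace μ₁ μ₂,
        zeroOneLoss (network h a W (assemble μ₁ μ₂ (z, ξ)).1) (assemble μ₁ μ₂ (z, ξ)).2 =
        zeroOneLoss (network h a W ξ) (assemble μ₁ μ₂ (z, ξ)).2 := fun z hz => by
      rw [← hnet z hz ξ]; rfl
    have hp : ∀ z ∈ ({μ₁, -μ₁} : Set (EuclideanSpace ℝ (Fin d))), z ∈ signalSpace μ₁ μ₂ →
        (assemble μ₁ μ₂ (z, ξ)).2 = 1 := fun z hz hzK =>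
      (inner_sq_sub_inner_sq h1 h2 h12).1 (by rw [starProjection_assemble hzK]; exact hz)
    have hq : ∀ z ∈ ({μ₂, -μ₂} : Set (EuclideanSpace ℝ (Fin d))), z ∈ signalSpace μ₁ μ₂ →
        (assemble μ₁ μ₂ (z, ξ)).2 = -1 := fun z hz hzK =>
      (inner_sq_sub_inner_sq h1 h2 h12).2 (by rw [starProjection_assemble hzK]; exact hz)
    have k1 : μ₁ ∈ signalSpace μ₁ μ₂ := left_mem_signalSpace
    have k2 : μ₂ ∈ signalSpace μ₁ μ₂ := right_mem_signalSpace
    rw [clusterLaw, integral_smul_measure,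
      integral_add_measure (((hint _ _).add_measure (hint _ _)).add_measure (hint _ _)) (hint _ _),
      integral_add_measure ((hint _ _).add_measure (hint _ _)) (hint _ _),
      integral_add_measure (hint _ _) (hint _ _),
      integral_dirac, integral_dirac, integral_dirac, integral_dirac,
      hlab _ k1, hlab _ (neg_mem k1), hlab _ k2, hlab _ (neg_mem k2),
      hp _ (by simp) k1, hp _ (by simp) (neg_mem k1), hq _ (by simp) k2,
      hq _ (by simp) (neg_mem k2)]
    have hs1 : signLabel 1 = 1 := if_pos zero_le_one
    have hs2 : signLabel (-1) = -1 := if_neg (by norm_num)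
    simp only [zeroOneLoss, hs1, hs2]
    by_cases hs : 0 ≤ network h a W ξ
    · rw [signLabel, if_pos hs]; norm_num
    · rw [signLabel, if_neg hs]; norm_num
  simp only [hval]
  simp

end

/-! ### Typical samples are likely -/

section

variable {d : ℕ} {μ₁ μ₂ : EuclideanSpace ℝ (Fin d)}

theorem finrank_orthogonal_signalSpace (h1 : ‖μ₁‖ = 1) (h2 : ‖μ₂‖ = 1) (h12 : ⟪μ₁, μ₂⟫ = 0) :
    2 + Module.finrank ℝ ↥(signalSpace μ₁ μ₂)ᗮ = d := by
  have ho : Orthonormal ℝ ![μ₁, μ₂] := by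
    rw [orthonormal_iff_ite]
    have h21 : ⟪μ₂, μ₁⟫ = 0 := by rw [real_inner_comm]; exact h12
    intro i j
    fin_cases i <;> fin_cases j <;> simp [h1, h2, h12, h21]
  have hs : signalSpace μ₁ μ₂ = Submodule.span ℝ (Set.range ![μ₁, μ₂]) := by
    rw [signalSpace]
    congr 1
    simp [Matrix.range_cons, Set.pair_comm]
  have h := (signalSpace μ₁ μ₂).finrank_add_finrank_orthogonal
  rw [finrank_euclideanSpace_fin] at h
  have h2K : Module.finrank ℝ ↥(signalSpace μ₁ μ₂) = 2 := by
    rw [hs, finrank_span_eq_card ho.linearIndependent, Fintype.card_fin]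
  omega

/-- A sample fails to be typical with exponentially small probability. -/
theorem measure_not_isTypical_le {n : ℕ} (hn : 0 < n) {σ : ℝ} (hσ : 0 < σ) (hd : 2 < d)
    (h1 : ‖μ₁‖ = 1) (h2 : ‖μ₂‖ = 1) (h12 : ⟪μ₁, μ₂⟫ = 0) {δ : ℝ} (hδ0 : 0 ≤ δ) (hδ : δ ≤ 1) :
    (Measure.pi fun _ : Fin n => xorDistribution μ₁ μ₂ σ)
      {S | ¬ IsTypical μ₁ μ₂ δ (((d : ℝ) - 2) * σ ^ 2) S} ≤
      ENNReal.ofReal (2 * 5 ^ n * Real.exp (-(((d : ℝ) - 2) * (δ / 32) ^ 2 / 8)) +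
        4 * Real.exp (-(n * δ ^ 2 / 8))) := by
  classical
  set 𝒟 := xorDistribution μ₁ μ₂ σ with h𝒟
  have hfin := finrank_orthogonal_signalSpace h1 h2 h12
  have hfpos : 0 < Module.finrank ℝ ↥(signalSpace μ₁ μ₂)ᗮ := by omega
  have hD : (Module.finrank ℝ ↥(signalSpace μ₁ μ₂)ᗮ : ℝ) = (d : ℝ) - 2 := by
    rw [eq_sub_iff_add_eq']
    exact_mod_cast hfin
  have hd2 : (0 : ℝ) ≤ (d : ℝ) - 2 := by rw [← hD]; positivity
  -- the junk components of the samples are independent with law `junkLaw`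
  have hG : (Measure.pi fun _ : Fin n => 𝒟) {S | ¬ ∀ a : Fin n → ℝ,
      |‖∑ j, a j • junk μ₁ μ₂ (S j).1‖ ^ 2 - ((d : ℝ) - 2) * σ ^ 2 * ∑ j, a j ^ 2| ≤
        δ * (((d : ℝ) - 2) * σ ^ 2 * ∑ j, a j ^ 2)} ≤
      ENNReal.ofReal (2 * 5 ^ n * Real.exp (-(((d : ℝ) - 2) * (δ / 32) ^ 2 / 8))) := by
    have : Nontrivial ↥(signalSpace μ₁ μ₂)ᗮ := Module.nontrivial_of_finrank_pos hfpos
    have hs : ∀ᵐ x ∂junkLaw μ₁ μ₂ σ, ‖x‖ ^ 2 = ((d : ℝ) - 2) * σ ^ 2 := by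
      filter_upwards [ae_norm_uniformSphere (F := ↥(signalSpace μ₁ μ₂)ᗮ)
        (r := Real.sqrt ((d : ℝ) - 2) * σ) (by positivity)] with x hx
      rw [hx, mul_pow, Real.sq_sqrt hd2]
    have hmgf := lintegral_exp_inner_le (ν := junkLaw μ₁ μ₂ σ)
      (fun e => map_uniformSphere e _) hfpos (s := σ ^ 2) (by rw [hD]; exact hs)
    have hmain := measure_gram_deviation_le hd2 (by positivity) hs hmgf n hδ0 hδ
    have hjm : Measurable fun p : EuclideanSpace ℝ (Fin d) × ℝ => junk μ₁ μ₂ p.1 :=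
      measurable_junk.comp measurable_fst
    have hpi := Measure.pi_map_pi (μ := fun _ : Fin n => 𝒟)
      (f := fun _ p => junk μ₁ μ₂ p.1) (fun _ => hjm.aemeasurable)
    simp only [h𝒟, map_junk_xorDistribution] at hpi
    rw [← hpi] at hmain
    have hjm' : Measurable fun (S : Fin n → EuclideanSpace ℝ (Fin d) × ℝ) j =>
        junk μ₁ μ₂ (S j).1 := measurable_pi_lambda _ fun j => hjm.comp (measurable_pi_apply j)
    exact (Measure.map_apply hjm'
      (isClosed_gram n (((d : ℝ) - 2) * σ ^ 2) δ).measurableSet.compl).symm.le.trans hmain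
  -- the signal components are independent with law `clusterLaw`, which gives `c` mass `1 / 4`
  have hC : ∀ c ∈ ({μ₁, -μ₁, μ₂, -μ₂} : Set (EuclideanSpace ℝ (Fin d))),
      (Measure.pi fun _ : Fin n => 𝒟)
        {S | ((clusterIndices μ₁ μ₂ S c).card : ℝ) < (1 - δ) * n / 4} ≤
      ENNReal.ofReal (Real.exp (-(n * δ ^ 2 / 8))) := by
    intro c hc
    set A : Set (EuclideanSpace ℝ (Fin d) × ℝ) :=
      {p | (signalSpace μ₁ μ₂).starProjection p.1 = c} with hA
    have hpm : Measurable fun p : EuclideanSpace ℝ (Fin d) × ℝ =>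
      (signalSpace μ₁ μ₂).starProjection p.1 := by fun_prop
    have hAm : MeasurableSet A := hpm (measurableSet_singleton c)
    have hA4 : 𝒟.real A = 1 / 4 := by
      rw [← clusterLaw_singleton h1 h2 h12 hc, ← map_starProjection_xorDistribution σ,
        map_measureReal_apply hpm (measurableSet_singleton c)]
      rfl
    refine le_trans (measure_mono fun S hS => ?_) (measure_card_lt_le hAm hA4 hn hδ0)
    have : ∑ j, A.indicator (fun _ => (1 : ℝ)) (S j) = (clusterIndices μ₁ μ₂ S c).card := by
      simp [Set.indicator_apply, hA, clusterIndices, Finset.sum_boole]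
    simp only [Set.mem_ofPred_eq] at hS ⊢
    rwa [this]
  -- the first two conditions of typicality hold almost surely
  have hE : (Measure.pi fun _ : Fin n => 𝒟) {S | ¬ ∀ j,
      (signalSpace μ₁ μ₂).starProjection (S j).1 ∈
        ({μ₁, -μ₁, μ₂, -μ₂} : Set (EuclideanSpace ℝ (Fin d))) ∧
      (S j).2 = ⟪μ₁, (S j).1⟫ ^ 2 - ⟪μ₂, (S j).1⟫ ^ 2} = 0 := by
    rw [← ae_iff, ae_all_iff]
    exact fun j => (Measure.quasiMeasurePreserving_eval (fun _ : Fin n => 𝒟) j).ae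
      (ae_xorDistribution σ)
  have hsub : {S | ¬ IsTypical μ₁ μ₂ δ (((d : ℝ) - 2) * σ ^ 2) S} ⊆
      {S : Fin n → EuclideanSpace ℝ (Fin d) × ℝ | ¬ ∀ a : Fin n → ℝ,
        |‖∑ j, a j • junk μ₁ μ₂ (S j).1‖ ^ 2 - ((d : ℝ) - 2) * σ ^ 2 * ∑ j, a j ^ 2| ≤
        δ * (((d : ℝ) - 2) * σ ^ 2 * ∑ j, a j ^ 2)} ∪
      ((⋃ c ∈ ({μ₁, -μ₁, μ₂, -μ₂} : Finset (EuclideanSpace ℝ (Fin d))),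
        {S | ((clusterIndices μ₁ μ₂ S c).card : ℝ) < (1 - δ) * n / 4}) ∪
      {S | ¬ ∀ j, (signalSpace μ₁ μ₂).starProjection (S j).1 ∈
          ({μ₁, -μ₁, μ₂, -μ₂} : Set (EuclideanSpace ℝ (Fin d))) ∧
        (S j).2 = ⟪μ₁, (S j).1⟫ ^ 2 - ⟪μ₂, (S j).1⟫ ^ 2}) := by
    intro S hS
    by_contra hcon
    simp only [Set.mem_union, not_or, Set.mem_ofPred_eq, not_not, Set.mem_iUnion, not_exists,
      not_lt] at hcon
    obtain ⟨k1, k2, k3⟩ := hcon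
    exact hS ⟨fun j => (k3 j).1, fun j => (k3 j).2, fun c hc => k2 c (by simpa using hc), k1⟩
  refine (measure_mono hsub).trans ((measure_union_le _ _).trans ?_)
  rw [ENNReal.ofReal_add (by positivity) (by positivity)]
  refine add_le_add hG ((measure_union_le _ _).trans ?_)
  rw [hE, add_zero]
  refine (measure_biUnion_finset_le _ _).trans ?_
  refine (Finset.sum_le_card_nsmul _ _ _ fun c hc => hC c (by simpa using hc)).trans ?_
  rw [nsmul_eq_mul, ENNReal.ofReal_mul (by norm_num), ENNReal.ofReal_ofNat]
  refine mul_le_mul_left ?_ _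
  exact_mod_cast Finset.card_le_four

end

/-- The numerical choice of the constant: `5 ^ n` is absorbed as `d ≥ c n`, and when `n` is so small
that the tail bounds are of no use, `3 exp (-n / c)` is at least `1`. -/
theorem failure_bound {δ c : ℝ} {n d : ℕ} (hδ0 : 0 < δ) (hδ : δ ≤ 1 / 8)
    (hc : c = 49152 / δ ^ 2) (hn : 0 < n) (hd : c * n ≤ d) (hd2 : (d : ℝ) / 2 ≤ (d : ℝ) - 2) :
    min 1 (2 * 5 ^ n * Real.exp (-(((d : ℝ) - 2) * (δ / 32) ^ 2 / 8)) +
        4 * Real.exp (-(n * δ ^ 2 / 8))) ≤ 3 * Real.exp (-(n : ℝ) / c) := by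
  have hn' : (0 : ℝ) < n := by exact_mod_cast hn
  have hδ2 : 0 < δ ^ 2 := by positivity
  have hδ21 : δ ^ 2 ≤ 1 := by nlinarith
  set u := Real.exp (-(n : ℝ) / c) with hu
  have hu0 : 0 < u := Real.exp_pos _
  have hb : Real.exp (-(n * δ ^ 2 / 8)) ≤ u ^ 2 := by
    rw [hu, ← Real.exp_nat_mul, Real.exp_le_exp, hc]
    have : -(n : ℝ) / (49152 / δ ^ 2) = -(n * δ ^ 2 / 49152) := by field_simp
    rw [this]
    push_cast
    nlinarith [mul_pos hn' hδ2]
  have h5 : (5 : ℝ) ≤ Real.exp 2 := by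
    have h := Real.exp_one_gt_d9
    rw [show (2 : ℝ) = 1 + 1 by norm_num, Real.exp_add]
    nlinarith
  have ha : 5 ^ n * Real.exp (-(((d : ℝ) - 2) * (δ / 32) ^ 2 / 8)) ≤ u ^ 2 := by
    have h1 : (5 : ℝ) ^ n ≤ Real.exp (n * 2) := by
      rw [Real.exp_nat_mul]; gcongr
    have h2 : 3 * (n : ℝ) ≤ ((d : ℝ) - 2) * (δ / 32) ^ 2 / 8 := by
      have h3 : 49152 * (n : ℝ) ≤ d * δ ^ 2 := by
        rw [hc, div_mul_eq_mul_div, div_le_iff₀ hδ2] at hd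
        exact hd
      nlinarith [mul_le_mul_of_nonneg_right hd2 hδ2.le]
    calc _ ≤ Real.exp (n * 2) * Real.exp (-(3 * n)) := by gcongr
      _ = Real.exp (-n) := by rw [← Real.exp_add]; congr 1; ring
      _ ≤ Real.exp (-(n * δ ^ 2 / 8)) := by
          rw [Real.exp_le_exp]
          nlinarith [mul_le_mul_of_nonneg_left hδ21 hn'.le]
      _ ≤ _ := hb
  rcases le_or_gt 1 (3 * u) with h | h
  · exact (min_le_left _ _).trans h
  · refine (min_le_right _ _).trans ?_
    have : u ^ 2 ≤ u / 3 := by nlinarith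
    linarith

theorem theorem3 (h : ℝ) (hh1 : 1 ≤ h) (hh2 : h < 2)
    (κgen : ℝ) (hκgen : IsKappaGen h κgen)
    (κ : ℝ) (hκ : κ < κgen) (ε : ℝ) (hε : 0 < ε) :
    ∃ c : ℝ, 0 < c ∧
      ∀ (n d : ℕ) (σ : ℝ), 0 < n → 0 < σ → κ = (n : ℝ) / ((d : ℝ) * σ ^ 2) →
        c ≤ (d : ℝ) / (n : ℝ) →
      ∀ (m : ℕ) (a : Fin m → ℝ), 0 < m → 4 ∣ m → (∀ i, a i = 1 ∨ a i = -1) → ∑ i, a i = 0 →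
      ∀ μ₁ μ₂ : EuclideanSpace ℝ (Fin d), ‖μ₁‖ = 1 → ‖μ₂‖ = 1 → inner ℝ μ₁ μ₂ = 0 →
        (Measure.pi fun _ : Fin n => xorDistribution μ₁ μ₂ σ)
            {S | ¬ ∃ W : Fin m → EuclideanSpace ℝ (Fin d),
              weightNorm W = 1 ∧
              (1 - ε) * maxMargin h a S ≤ margin (network h a W) S ∧
              signalComponent μ₁ μ₂ W = 0 ∧
              testLoss (xorDistribution μ₁ μ₂ σ) (network h a W) = 1 / 2} ≤
          ENNReal.ofReal (3 * Real.exp (-(n : ℝ) / c)) := by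
  set δ := min ε 1 / 8 with hδ
  have hδ0 : 0 < δ := by positivity
  have hδ1 : δ ≤ 1 / 8 := by rw [hδ]; gcongr; exact min_le_right _ _
  have hδε : 4 * δ ≤ ε := by have := min_le_left ε 1; linarith
  refine ⟨49152 / δ ^ 2, by positivity, ?_⟩
  intro n d σ hn hσ hκd hcd m a hm _ ha ha0 μ₁ μ₂ h1 h2 h12
  have hn' : (0 : ℝ) < n := by exact_mod_cast hn
  have hn1 : (1 : ℝ) ≤ n := by exact_mod_cast hn
  rw [le_div_iff₀ hn'] at hcd
  have hc0 : 0 < 49152 / δ ^ 2 := by positivity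
  have hcd' : 49152 / δ ^ 2 ≤ d := le_trans (le_mul_of_one_le_right hc0.le hn1) hcd
  have hd2δ : 2 ≤ δ * d := by
    rw [div_le_iff₀ (by positivity)] at hcd'
    nlinarith [mul_nonneg (Nat.cast_nonneg (α := ℝ) d) hδ0.le]
  have hd4 : (16 : ℝ) ≤ d := by
    nlinarith [mul_le_mul_of_nonneg_right hδ1 (Nat.cast_nonneg (α := ℝ) d)]
  have hd0 : (0 : ℝ) < d := by linarith
  have hd2 : 2 < d := by
    have : (2 : ℝ) < d := by linarith
    exact_mod_cast this
  have hκ0 : 0 < κ := by rw [hκd]; positivity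
  set R := ((d : ℝ) - 2) * σ ^ 2 with hR
  have hR0 : 0 < R := mul_pos (by linarith) (by positivity)
  have hκR : κ * R = n * (((d : ℝ) - 2) / d) := by
    rw [hκd, hR]; field_simp
  have hle : ((d : ℝ) - 2) / d ≤ 1 := by rw [div_le_one hd0]; linarith
  have hge : 1 - δ ≤ ((d : ℝ) - 2) / d := by rw [le_div_iff₀ hd0]; linarith
  have hκh : 4 + κ ≤ (2 : ℝ) ^ (1 + 2 / h) := by
    have := (isKappaGen_iff hh1 hh2).1 hκgen
    linarith
  calc _ ≤ (Measure.pi fun _ : Fin n => xorDistribution μ₁ μ₂ σ)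
        {S | ¬ IsTypical μ₁ μ₂ δ R S} := by
        refine measure_mono fun S hS hT => hS ?_
        obtain ⟨W, hW1, hWm, hWK⟩ := exists_junk_network_near_optimal hT hn hδ0.le (by linarith)
          hR0 hh1 hh2.le hκ0 hκh (by rw [hκR]; nlinarith) (by rw [hκR]; nlinarith)
          h1 h2 h12 hm ha ha0 hδε
        exact ⟨W, hW1, hWm, funext fun i =>
          (Submodule.starProjection_apply_eq_zero_iff _).2 (hWK i),
          testLoss_eq_half h1 h2 h12 σ a hWK⟩
    _ ≤ ENNReal.ofReal (min 1 (2 * 5 ^ n * Real.exp (-(((d : ℝ) - 2) * (δ / 32) ^ 2 / 8)) +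
        4 * Real.exp (-(n * δ ^ 2 / 8)))) := by
        rw [ENNReal.ofReal_min, ENNReal.ofReal_one]
        exact le_min prob_le_one
          (measure_not_isTypical_le hn hσ hd2 h1 h2 h12 hδ0.le (by linarith))
    _ ≤ _ := ENNReal.ofReal_le_ofReal (failure_bound hδ0 hδ1 rfl hn hcd (by linarith))
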